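/- **Setting.** Let $\Pi=\{p_1,\dots,p_n\}$, $n\ge 2$, be asynchronous processes that communicate through shared memory: each process owns an atomic register, which it writes, and can take atomic snapshots of all registers. A protocol is a (deterministic) program for each process. An execution is a pair $(I,\sigma)$ of an input vector $I$ and an infinite sequence $\sigma$ of process ids; the processes that occur in $\sigma$ are *participating* and those that occur infinitely often are *correct*. A process may post in the shared memory an output value for itself or for another participating process; a process *terminates* when an output value is posted for it. A *task* $T=(\mathcal I,\mathcal O,\Delta)$ consists of a set $\mathcal I$ of input $n$-vectors ($\bot$ for a non-participating process), a set $\mathcal O$ of output $n$-vectors ($\bot$ for a non-terminated process) and a total relation $\Delta\subseteq\mathcal I\times\mathcal O$. The executions considered for $T$ are those with $I\in\mathcal I$ in which exactly the processes with a non-$\bot$ component in $I$ participate. The posted outputs of an execution *respect* $T$ if they are posted for participating processes only and form a vector $O$ (at most one value for each process, $\bot$ if there is none) with $(I,O)\in\Delta$. Let $\mathrm{val}(U)$ be the set of non-$\bot$ values of a vector $U$. The task $T$ is *colorless* if * $I\in\mathcal I$ and $\mathrm{val}(I')\subseteq\mathrm{val}(I)$ imply $I'\in\mathcal I$; * $(I,O)\in\Delta$,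 $I'\in\mathcal I$ and $\mathrm{val}(I)\subseteq\mathrm{val}(I')$ imply $(I',O)\in\Delta$; * $(I,O)\in\Delta$ and $\mathrm{val}(O')\subseteq\mathrm{val}(O)$ imply $(I,O')\in\Delta$. Let $\mathcal L$ be a non-empty collection of non-empty subsets of $\Pi$ (*live sets*), and let $h=h(\Pi,\mathcal L)$ be the minimum cardinality of a subset of $\Pi$ that meets every set in $\mathcal L$. An execution is *$\mathcal L$-resilient* if all processes of some $L\in\mathcal L$ are correct. The task $T$ is *weakly $\mathcal L$-resiliently solvable* if there is a protocol such that, in every $\mathcal L$-resilient execution, all processes of some (possibly different) participating set in $\mathcal L$ terminate, and the posted outputs respect $T$. It is *$t$-resiliently solvable* if there is a protocol such that, in every execution with at least $n-t$ correct processes, every correct process terminates, and the posted outputs respect $T$. **Theorem.** A colorless task $T$ is weakly $\mathcal L$-resiliently solvable if and only if it is $(h(\Pi,\mathcal L)-1)$-resiliently solvable. Consequently, if $\mathcal L'$ is another non-empty collection of non-empty subsets of $\Pi$ and $h(\Pi,\mathcal L')=h(\Pi,\mathcal L)$, then $T$ is weakly $\mathcal L$-resiliently solvable if and only if it is weakly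 $\mathcal L'$-resiliently solvable. -/

import Mathlib

universe u

namespace Resilience

/-! ### Vectors and tasks -/

/-- `n`-vectors with one component per process, where `none` plays the role of `⊥`. -/
abbrev Vec (n : ℕ) (X : Type u) : Type u := Fin n → Option X

/-- The set of non-`⊥` values of a vector. -/
def Vec.val {n : ℕ} {X : Type u} (U : Vec n X) : Set X := {x | ∃ p, U p = some x}

/-- A distributed task for `n` processes: a set of input vectors (`⊥` for a non-participating
process), a set of output vectors (`⊥` for a non-terminated process), and a total relation
between them. -/
structure DistTask (n : ℕ) (V W : Type u) where
  inputs : Set (Vec n V)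
  outputs : Set (Vec n W)
  rel : Vec n V → Vec n W → Prop
  mem_of_rel : ∀ I O, rel I O → I ∈ inputs ∧ O ∈ outputs
  total : ∀ I ∈ inputs, ∃ O, rel I O

/-- Colorless tasks: processes are free to adopt each other's input and output values.
* A vector whose values all occur in an input vector is an input vector.
* An output vector allowed for `I` is allowed for every input vector that has at least the
  values of `I`.
* If `O` is allowed for `I`, so is every vector whose values all occur in `O`. -/
structure DistTask.Colorless {n : ℕ} {V W : Type u} (T : DistTask n V W) : Prop where
  inputs_closed : ∀ I ∈ T.inputs, ∀ I' : Vec n V, I'.val ⊆ I.val → I' ∈ T.inputs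
  rel_mono : ∀ I O, T.rel I O → ∀ I' ∈ T.inputs, I.val ⊆ I'.val → T.rel I' O
  rel_anti : ∀ I O, T.rel I O → ∀ O' : Vec n W, O'.val ⊆ O.val → T.rel I O'

/-! ### Shared-memory protocols -/

/-- One atomic operation of a process, together with the local state it leads to. Every process
owns one register, which it alone writes; the operations are to write that register, or to take
an atomic snapshot of all the registers (`none` in a register that was never written). -/
inductive Act (n : ℕ) (S C : Type u) : Type u
  | write (c : C) (next : S) : Act n S C
  | snapshot (next : (Fin n → Option C) → S) : Act n S C

/-- A (deterministic, asynchronous) shared-memory protocol for `n` processes. -/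
structure Protocol (n : ℕ) (V W : Type u) where
  /-- local states -/
  State : Type u
  /-- register contents -/
  Cell : Type u
  /-- the initial state of a process, given its component of the input vector (the value at `⊥`
  is immaterial, as a process with input `⊥` takes no step) -/
  init : Fin n → Option V → State
  /-- the next operation of a process, determined by its local state -/
  act : Fin n → State → Act n State Cell
  /-- `out c q = some w`: the register content `c` includes the output value `w` posted for
  process `q` -/
  out : Cell → Fin n → Option W

/-- The local states of the processes and the contents of their registers. -/
structure Protocol.Config {n : ℕ} {V W : Type u} (A : Protocol n V W) where
  loc : Fin n → A.State
  mem : Fin n → Option A.Cell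

/-- The effect of one step of process `p`. -/
def Protocol.step {n : ℕ} {V W : Type u} (A : Protocol n V W) (x : A.Config) (p : Fin n) :
    A.Config :=
  match A.act p (x.loc p) with
  | .write c s => ⟨Function.update x.loc p s, Function.update x.mem p (some c)⟩
  | .snapshot f => ⟨Function.update x.loc p (f x.mem), x.mem⟩

/-! ### Executions -/

/-- An execution `(I, σ)`: an input vector and a sequence of process ids. (Finite sequences are
left out: they have no correct process, and resilience, with nonempty live sets, always demands
at least one.) -/
structure Execution (n : ℕ) (V : Type u) where
  input : Vec n V
  sched : ℕ → Fin n

/-- The processes that take at least one step. -/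
def Execution.participating {n : ℕ} {V : Type u} (e : Execution n V) : Set (Fin n) :=
  {p | ∃ k, e.sched k = p}

/-- The processes that take infinitely many steps. -/
def Execution.correct {n : ℕ} {V : Type u} (e : Execution n V) : Set (Fin n) :=
  {p | ∀ m, ∃ k, m ≤ k ∧ e.sched k = p}

/-- The executions for a task: those from an input vector of the task in which exactly the
processes with a non-`⊥` input participate. -/
def DistTask.IsExecution {n : ℕ} {V W : Type u} (T : DistTask n V W) (e : Execution n V) : Prop :=
  e.input ∈ T.inputs ∧ ∀ p, p ∈ e.participating ↔ e.input p ≠ none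

/-- The configuration of protocol `A` after `k` steps of the execution `e`. -/
def Protocol.run {n : ℕ} {V W : Type u} (A : Protocol n V W) (e : Execution n V) : ℕ → A.Config
  | 0 => ⟨fun p => A.init p (e.input p), fun _ => none⟩
  | k + 1 => A.step (Protocol.run A e k) (e.sched k)

/-- In execution `e`, some process posts the output value `w` for process `q` (possibly with
`q` another process). -/
def Protocol.Posts {n : ℕ} {V W : Type u} (A : Protocol n V W) (e : Execution n V)
    (q : Fin n) (w : W) : Prop :=
  ∃ k p c, (A.run e k).mem p = some c ∧ A.out c q = some w

/-- A process terminates when an output value is posted for it. -/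
def Protocol.Terminates {n : ℕ} {V W : Type u} (A : Protocol n V W) (e : Execution n V)
    (q : Fin n) : Prop :=
  ∃ w, A.Posts e q w

/-- The posted outputs respect the task: they are posted for participating processes only, and
they form an output vector (so no process gets two different outputs) which the task allows for
the input vector. -/
def Protocol.Respects {n : ℕ} {V W : Type u} (A : Protocol n V W) (T : DistTask n V W)
    (e : Execution n V) : Prop :=
  (∀ q w, A.Posts e q w → q ∈ e.participating) ∧
    ∃ O : Vec n W, (∀ q w, A.Posts e q w ↔ O q = some w) ∧ T.rel e.input O

/-! ### Resilience and hitting sets -/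

/-- An execution is resilient for a collection of live sets if all the processes of some live
set are correct. -/
def Execution.IsResilient {n : ℕ} {V : Type u} (e : Execution n V) (𝓛 : Set (Set (Fin n))) :
    Prop :=
  ∃ L ∈ 𝓛, L ⊆ e.correct

/-- Weak solvability for a collection `𝓛` of live sets: some protocol guarantees, in every
`𝓛`-resilient execution, that all the processes of some (possibly different) participating set
in `𝓛` terminate, and that the posted outputs respect the task. -/
def DistTask.WeaklySolvable {n : ℕ} {V W : Type u} (T : DistTask n V W)
    (𝓛 : Set (Set (Fin n))) : Prop :=
  ∃ A : Protocol n V W, ∀ e, T.IsExecution e → e.IsResilient 𝓛 →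
    (∃ L ∈ 𝓛, L ⊆ e.participating ∧ ∀ q ∈ L, A.Terminates e q) ∧ A.Respects T e

/-- `t`-resilient solvability: some protocol guarantees, in every execution with at least `n - t`
correct processes, that every correct process terminates, and that the posted outputs respect
the task. -/
def DistTask.ResilientlySolvable {n : ℕ} {V W : Type u} (T : DistTask n V W) (t : ℕ) : Prop :=
  ∃ A : Protocol n V W, ∀ e, T.IsExecution e → n ≤ e.correct.ncard + t →
    (∀ q ∈ e.correct, A.Terminates e q) ∧ A.Respects T e

/-- `h(Π, 𝓛)`: the least cardinality of a set of processes that meets every set in `𝓛` (there is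
such a set as soon as `∅ ∉ 𝓛`). -/
noncomputable def hittingSize {n : ℕ} (𝓛 : Set (Set (Fin n))) : ℕ :=
  sInf {k | ∃ H : Finset (Fin n), H.card = k ∧ ∀ L ∈ 𝓛, ∃ p ∈ H, p ∈ L}

end Resilience

/-! Both directions are instances of one simulation in the style of Borowsky and Gafni. Let $H$ be a
minimum hitting set, $|H|=h$. The processes in $H$ jointly simulate a given protocol, and every
process adopts an output value as soon as it finds one. If a member of $H$ is correct, at most $h-1$
simulated processes stop. Since $h-1$ processes cannot meet every live set, the simulated execution
is $\mathcal L$-resilient as well as $(h-1)$-resilient, so a protocol of either kind posts an output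
in it. In the real execution, a member of $H$ is correct if at most $h-1$ processes are faulty, and
also if some live set is correct. Colorlessness permits simulating with borrowed inputs and adopting
the outputs (`exists_simulation`).

Liveness: each step of a simulated process is settled by a safe agreement on a view of the simulated
memory and an input. A simulator announces that it enters, takes a snapshot, and wins if it sees no
winning proposal; its next write publishes the win and withdraws the announcement. Once a winner is
visible and nobody is inside, the winners are frozen (`wins_eq_of_resolved`), so everyone selects
the same one. A simulator is inside one agreement at a time, so a faulty one blocks at most one
simulated process (`exists_blocking`, `ncard_infinite`).

Safety: a simulated write takes effect when its completion is first published, a simulated snapshot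
when the selected simulator read the view that it proposed. With these linearization points
(`count_write`, `count_snapshot`) the agreed results form a genuine execution (`exists_execution`).
-/

namespace Resilience

variable {n : ℕ} {V W : Type u}

/-! ### Replaying a single process -/

/-- The effect of one step on the local state and the register of process `j`, when the memory
is `view`. -/
def Protocol.localStep (A : Protocol n V W) (j : Fin n) (s : A.State × Option A.Cell)
    (view : Fin n → Option A.Cell) : A.State × Option A.Cell :=
  match A.act j s.1 with
  | .write c s' => (s', some c)
  | .snapshot f => (f view, s.2)

/-- The local state and the register of process `j` with input `i` after a number of steps, when
`view k` is the memory at step `k`. -/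
def Protocol.replay (A : Protocol n V W) (j : Fin n) (i : Option V)
    (view : ℕ → Fin n → Option A.Cell) : ℕ → A.State × Option A.Cell
  | 0 => (A.init j i, none)
  | k + 1 => A.localStep j (A.replay j i view k) (view k)

theorem Protocol.replay_congr (A : Protocol n V W) (j : Fin n) (i : Option V)
    {f g : ℕ → Fin n → Option A.Cell} {k : ℕ} (h : ∀ l < k, f l = g l) :
    A.replay j i f k = A.replay j i g k := by
  induction k with
  | zero => rfl
  | succ k ih =>
    simp only [Protocol.replay]
    rw [ih fun l hl => h l (by omega), h k (by omega)]

theorem Protocol.step_eq (A : Protocol n V W) (x : A.Config) (p : Fin n) :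
    A.step x p = ⟨Function.update x.loc p (A.localStep p (x.loc p, x.mem p) x.mem).1,
      Function.update x.mem p (A.localStep p (x.loc p, x.mem p) x.mem).2⟩ := by
  unfold Protocol.step Protocol.localStep
  cases h : A.act p (x.loc p) <;> simp

/-! ### The simulation -/

/-- What a simulator proposes as the result of a simulated step: a view of the simulated memory
and an input value. -/
structure Proposal (A : Protocol n V W) : Type u where
  view : Fin n → Option A.Cell
  input : Option V

/-- The data of a simulator, which it publishes in its register. -/
structure SimData (A : Protocol n V W) : Type u where
  /-- the number of snapshots taken so far -/
  round : ℕ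
  input : Option V
  /-- the number of steps of each simulated process known to be completed -/
  steps : Fin n → ℕ
  /-- the safe agreement (for a simulated process and a step number) that is being accessed -/
  entered : Option (Fin n × ℕ)
  /-- the proposals that were made without seeing another one -/
  won : Fin n → ℕ → Option (Proposal A)
  /-- the output value adopted, with the process for which it is posted -/
  output : Option (Fin n × W)

namespace SimData

variable {A : Protocol n V W}

/-- The number of steps of process `j` published as completed. -/
def progress (M : Fin n → Option (SimData A)) (j : Fin n) : ℕ :=
  Finset.univ.sup fun q => (M q).elim 0 fun x => x.steps j

/-- The published winning proposals for step `k` of process `j`. -/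
def wins (M : Fin n → Option (SimData A)) (j : Fin n) (k : ℕ) : Fin n → Option (Proposal A) :=
  fun q => (M q).bind fun x => x.won j k

def HasWin (M : Fin n → Option (SimData A)) (j : Fin n) (k : ℕ) : Prop :=
  ∃ q v, wins M j k q = some v

/-- The safe agreement on step `k` of process `j` is resolved: there is a winning proposal and
no simulator is in the middle of proposing. -/
def Resolved (M : Fin n → Option (SimData A)) (j : Fin n) (k : ℕ) : Prop :=
  HasWin M j k ∧ ∀ q x, M q = some x → x.entered ≠ some (j, k)

open Classical in
/-- The selected one of several winning proposals. -/
noncomputable def selected (w : Fin n → Option (Proposal A)) : Option (Fin n × Proposal A) :=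
  if h : ∃ z : Fin n × Proposal A, w z.1 = some z.2 then some h.choose else none

/-- The proposal selected for step `k` of process `j`. -/
noncomputable def decision (M : Fin n → Option (SimData A)) (j : Fin n) (k : ℕ) : Proposal A :=
  (selected (wins M j k)).elim ⟨fun _ => none, none⟩ Prod.snd

/-- The simulated process `j` after `k` steps, as computed from the memory. -/
noncomputable def simState (M : Fin n → Option (SimData A)) (j : Fin n) (k : ℕ) :
    A.State × Option A.Cell :=
  A.replay j (decision M j 0).input (fun i => (decision M j i).view) k

/-- The current simulated memory. -/
noncomputable def simMem (M : Fin n → Option (SimData A)) : Fin n → Option A.Cell :=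
  fun j => (simState M j (progress M j)).2

/-- The value `w` was posted in the simulated execution. -/
def HasOutput (M : Fin n → Option (SimData A)) (w : W) : Prop :=
  -- All earlier register contents are inspected, as a posted value may since have been overwritten.
  ∃ j k c q, k ≤ progress M j ∧ (simState M j k).2 = some c ∧ A.out c q = some w

open Classical in
/-- The number of completed steps of `j` found by a simulator from its snapshot. -/
noncomputable def nextStep (M : Fin n → Option (SimData A)) (j : Fin n) : ℕ :=
  if Resolved M j (progress M j) then progress M j + 1 else progress M j

open Classical in
/-- How simulator `p` processes a snapshot: it completes the proposal it is making, and turns to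
the next simulated process, given by `τ`. -/
noncomputable def update (S : Finset (Fin n)) (τ : ℕ → Fin n) (p : Fin n) (x : SimData A)
    (M : Fin n → Option (SimData A)) : SimData A where
  round := x.round + 1
  input := x.input
  steps := Function.update x.steps (τ (x.round + 1)) (nextStep M (τ (x.round + 1)))
  entered :=
    if p ∈ S ∧ ¬ HasWin M (τ (x.round + 1)) (nextStep M (τ (x.round + 1))) then
      some (τ (x.round + 1), nextStep M (τ (x.round + 1)))
    else none
  won j k :=
    -- The test uses the old `entered`. As that field is replaced in the same update, one write both
    -- publishes the win and leaves the agreement.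
    if x.entered = some (j, k) ∧ ¬ HasWin M j k then some ⟨simMem M, x.input⟩ else x.won j k
  output := x.output.or (if h : ∃ w, HasOutput M w then some (p, h.choose) else none)

/-- The initial data of a simulator. -/
def initial (A : Protocol n V W) (i : Option V) : SimData A :=
  ⟨0, i, fun _ => 0, none, fun _ _ => none, none⟩

/-- `x'` is a later state of the data `x`. -/
structure Le (x x' : SimData A) : Prop where
  steps : ∀ j, x.steps j ≤ x'.steps j
  won : ∀ j k v, x.won j k = some v → x'.won j k = some v
  output : ∀ z, x.output = some z → x'.output = some z

/-! ### Monotonicity of the simulators' data -/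

theorem Le.refl (x : SimData A) : Le x x := ⟨fun _ => le_rfl, fun _ _ _ => id, fun _ => id⟩

theorem Le.trans {x y z : SimData A} (h : Le x y) (h' : Le y z) : Le x z :=
  ⟨fun j => (h.steps j).trans (h'.steps j), fun j k v hv => h'.won j k v (h.won j k v hv),
    fun w hw => h'.output w (h.output w hw)⟩

theorem steps_le_progress {M : Fin n → Option (SimData A)} {q : Fin n} {x : SimData A}
    (h : M q = some x) (j : Fin n) : x.steps j ≤ progress M j := by
  have : (M q).elim 0 (fun x => x.steps j) ≤ progress M j :=
    Finset.le_sup (f := fun q => (M q).elim 0 fun x => x.steps j) (Finset.mem_univ q)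
  simpa [h] using this

theorem exists_of_lt_progress {M : Fin n → Option (SimData A)} {j : Fin n} {k : ℕ}
    (h : k < progress M j) : ∃ q x, M q = some x ∧ k < x.steps j := by
  obtain ⟨q, -, hq⟩ := Finset.lt_sup_iff.1 h
  cases hM : M q with
  | none => simp [hM] at hq
  | some x => exact ⟨q, x, hM, by simpa [hM] using hq⟩

theorem progress_le {M : Fin n → Option (SimData A)} {j : Fin n} {k : ℕ}
    (h : ∀ q x, M q = some x → x.steps j ≤ k) : progress M j ≤ k := by
  by_contra hk
  obtain ⟨q, x, hq, hx⟩ := exists_of_lt_progress (not_le.1 hk)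
  exact absurd (h q x hq) (by omega)

theorem progress_le_nextStep (M : Fin n → Option (SimData A)) (j : Fin n) :
    progress M j ≤ nextStep M j := by
  unfold nextStep
  split_ifs <;> omega

/-- Because the register of `p` already shows `x`, earlier wins of `p` are visible in `M` and are
not replaced by a new proposal. -/
theorem le_update (S : Finset (Fin n)) (τ : ℕ → Fin n) {p : Fin n} {x : SimData A}
    {M : Fin n → Option (SimData A)} (h : M p = some x) : Le x (update S τ p x M) where
  steps j := by
    by_cases hj : j = τ (x.round + 1)
    · subst hj
      simpa [update] using (steps_le_progress h _).trans (progress_le_nextStep M _)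
    · simp [update, Function.update_of_ne hj]
  won j k v hv := by
    have : HasWin M j k := ⟨p, v, by simp [wins, h, hv]⟩
    simp [update, this, hv]
  output z hz := by simp [update, hz]

theorem selected_spec {w : Fin n → Option (Proposal A)} {z : Fin n × Proposal A}
    (h : selected w = some z) : w z.1 = some z.2 := by
  unfold selected at h
  split_ifs at h with h'
  · rw [← Option.some.inj h]
    exact h'.choose_spec

theorem exists_selected {w : Fin n → Option (Proposal A)} {q : Fin n} {v : Proposal A}
    (h : w q = some v) : ∃ z, selected w = some z := by
  unfold selected
  rw [dif_pos ⟨(q, v), h⟩]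
  exact ⟨_, rfl⟩

end SimData

open Classical in
/-- The protocol with which the processes in `S` simulate `A` and all processes adopt output
values of the simulated processes. -/
noncomputable def simulation (A : Protocol n V W) (S : Finset (Fin n)) (τ : ℕ → Fin n) :
    Protocol n V W where
  State := Bool × SimData A
  Cell := SimData A
  init _ i := (true, SimData.initial A i)
  act p s := if s.1 then .write s.2 (false, s.2)
    else .snapshot fun M => (true, SimData.update S τ p s.2 M)
  out c q := c.output.bind fun z => if z.1 = q then some z.2 else none

open SimData in
/-- The course of an execution of the simulation: `loc m p` is the data of process `p` after
`m` steps, `fresh m p` tells whether it is about to be written, and `mem m` is the memory. -/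
structure SimRun (A : Protocol n V W) (S : Finset (Fin n)) (τ : ℕ → Fin n)
    (e : Execution n V) where
  loc : ℕ → Fin n → SimData A
  fresh : ℕ → Fin n → Bool
  mem : ℕ → Fin n → Option (SimData A)
  loc_zero : ∀ p, loc 0 p = initial A (e.input p)
  fresh_zero : ∀ p, fresh 0 p = true
  mem_zero : ∀ p, mem 0 p = none
  fresh_succ : ∀ m, fresh (m + 1) = Function.update (fresh m) (e.sched m) (!fresh m (e.sched m))
  loc_write : ∀ m, fresh m (e.sched m) = true → loc (m + 1) = loc m
  mem_write : ∀ m, fresh m (e.sched m) = true →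
    mem (m + 1) = Function.update (mem m) (e.sched m) (some (loc m (e.sched m)))
  loc_snapshot : ∀ m, fresh m (e.sched m) = false → loc (m + 1) =
    Function.update (loc m) (e.sched m)
      (SimData.update S τ (e.sched m) (loc m (e.sched m)) (mem m))
  mem_snapshot : ∀ m, fresh m (e.sched m) = false → mem (m + 1) = mem m

/-- The course of the simulation in the execution `e`. -/
noncomputable def simRun (A : Protocol n V W) (S : Finset (Fin n)) (τ : ℕ → Fin n)
    (e : Execution n V) : SimRun A S τ e where
  loc m p := (((simulation A S τ).run e m).loc p).2
  fresh m p := (((simulation A S τ).run e m).loc p).1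
  mem m := ((simulation A S τ).run e m).mem
  loc_zero p := rfl
  fresh_zero p := rfl
  mem_zero p := rfl
  fresh_succ m := by
    funext q
    have : (simulation A S τ).run e (m + 1) =
      (simulation A S τ).step ((simulation A S τ).run e m) (e.sched m) := rfl
    rw [this]
    generalize (simulation A S τ).run e m = x
    by_cases h : (x.loc (e.sched m)).1 = true <;> by_cases hq : q = e.sched m <;>
      simp_all [Protocol.step, simulation]
  loc_write m h := by
    funext q
    have : (simulation A S τ).run e (m + 1) =
      (simulation A S τ).step ((simulation A S τ).run e m) (e.sched m) := rfl
    rw [this]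
    revert h
    generalize (simulation A S τ).run e m = x
    intro h
    by_cases hq : q = e.sched m <;> simp_all [Protocol.step, simulation]
  mem_write m h := by
    have : (simulation A S τ).run e (m + 1) =
      (simulation A S τ).step ((simulation A S τ).run e m) (e.sched m) := rfl
    rw [this]
    revert h
    generalize (simulation A S τ).run e m = x
    intro h
    simp_all [Protocol.step, simulation]
  loc_snapshot m h := by
    funext q
    have : (simulation A S τ).run e (m + 1) =
      (simulation A S τ).step ((simulation A S τ).run e m) (e.sched m) := rfl
    rw [this]
    revert h
    generalize (simulation A S τ).run e m = x
    intro h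
    by_cases hq : q = e.sched m <;> simp_all [Protocol.step, simulation]
  mem_snapshot m h := by
    have : (simulation A S τ).run e (m + 1) =
      (simulation A S τ).step ((simulation A S τ).run e m) (e.sched m) := rfl
    rw [this]
    revert h
    generalize (simulation A S τ).run e m = x
    intro h
    simp_all [Protocol.step, simulation]

namespace SimRun

open SimData

variable {A : Protocol n V W} {S : Finset (Fin n)} {τ : ℕ → Fin n} {e : Execution n V}

/-! ### Invariants of the simulation -/

theorem fresh_of_ne (R : SimRun A S τ e) {m : ℕ} {p : Fin n} (h : e.sched m ≠ p) :
    R.fresh (m + 1) p = R.fresh m p := by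
  rw [R.fresh_succ, Function.update_of_ne h.symm]

theorem loc_of_ne (R : SimRun A S τ e) {m : ℕ} {p : Fin n} (h : e.sched m ≠ p) :
    R.loc (m + 1) p = R.loc m p := by
  cases hf : R.fresh m (e.sched m) with
  | true => rw [R.loc_write m hf]
  | false => rw [R.loc_snapshot m hf, Function.update_of_ne h.symm]

theorem mem_of_ne (R : SimRun A S τ e) {m : ℕ} {p : Fin n} (h : e.sched m ≠ p) :
    R.mem (m + 1) p = R.mem m p := by
  cases hf : R.fresh m (e.sched m) with
  | true => rw [R.mem_write m hf, Function.update_of_ne h.symm]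
  | false => rw [R.mem_snapshot m hf]

/-- The three kinds of effect that a step has on process `p`. -/
theorem step_cases (R : SimRun A S τ e) (m : ℕ) (p : Fin n) :
    (e.sched m ≠ p ∧ R.fresh (m + 1) p = R.fresh m p ∧ R.loc (m + 1) p = R.loc m p ∧
      R.mem (m + 1) p = R.mem m p) ∨
    (e.sched m = p ∧ R.fresh m p = true ∧ R.fresh (m + 1) p = false ∧
      R.loc (m + 1) p = R.loc m p ∧ R.mem (m + 1) p = some (R.loc m p)) ∨
    (e.sched m = p ∧ R.fresh m p = false ∧ R.fresh (m + 1) p = true ∧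
      R.loc (m + 1) p = SimData.update S τ p (R.loc m p) (R.mem m) ∧
      R.mem (m + 1) = R.mem m) := by
  by_cases h : e.sched m = p
  · right
    subst h
    cases hf : R.fresh m (e.sched m) with
    | true =>
      left
      rw [R.fresh_succ, R.loc_write m hf, R.mem_write m hf]
      simp [hf]
    | false =>
      right
      rw [R.fresh_succ, R.loc_snapshot m hf, R.mem_snapshot m hf]
      simp [hf]
  · exact Or.inl ⟨h, R.fresh_of_ne h, R.loc_of_ne h, R.mem_of_ne h⟩

theorem mem_of_not_fresh (R : SimRun A S τ e) {m : ℕ} {p : Fin n} (h : R.fresh m p = false) :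
    R.mem m p = some (R.loc m p) := by
  induction m with
  | zero => simp [R.fresh_zero] at h
  | succ m ih =>
    rcases R.step_cases m p with ⟨-, h1, h2, h3⟩ | ⟨-, h0, h1, h2, h3⟩ | ⟨-, h0, h1, h2, h3⟩
    · rw [h2, h3, ih (h1 ▸ h)]
    · rw [h2, h3]
    · simp [h1] at h

theorem loc_le_succ (R : SimRun A S τ e) (m : ℕ) (p : Fin n) :
    Le (R.loc m p) (R.loc (m + 1) p) := by
  rcases R.step_cases m p with ⟨-, h1, h2, h3⟩ | ⟨-, h0, h1, h2, h3⟩ | ⟨-, h0, h1, h2, h3⟩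
  · exact h2 ▸ Le.refl _
  · exact h2 ▸ Le.refl _
  · exact h2 ▸ le_update S τ (R.mem_of_not_fresh h0)

theorem loc_le (R : SimRun A S τ e) {m m' : ℕ} (h : m ≤ m') (p : Fin n) :
    Le (R.loc m p) (R.loc m' p) := by
  induction m', h using Nat.le_induction with
  | base => exact Le.refl _
  | succ k _ ih => exact ih.trans (R.loc_le_succ k p)

theorem mem_le_loc (R : SimRun A S τ e) {m : ℕ} {p : Fin n} {y : SimData A}
    (h : R.mem m p = some y) : Le y (R.loc m p) := by
  induction m with
  | zero => simp [R.mem_zero] at h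
  | succ m ih =>
    rcases R.step_cases m p with ⟨-, h1, h2, h3⟩ | ⟨-, h0, h1, h2, h3⟩ | ⟨-, h0, h1, h2, h3⟩
    · exact (ih (h3 ▸ h)).trans (R.loc_le_succ m p)
    · rw [h3] at h
      rw [h2, Option.some.inj h]
      exact Le.refl _
    · exact (ih (h3 ▸ h)).trans (R.loc_le_succ m p)

theorem mem_mono_succ (R : SimRun A S τ e) {m : ℕ} {p : Fin n} {y : SimData A}
    (h : R.mem m p = some y) : ∃ y', R.mem (m + 1) p = some y' ∧ Le y y' := by
  rcases R.step_cases m p with ⟨-, h1, h2, h3⟩ | ⟨-, h0, h1, h2, h3⟩ | ⟨-, h0, h1, h2, h3⟩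
  · exact ⟨y, h3 ▸ h, Le.refl _⟩
  · exact ⟨_, h3, R.mem_le_loc h⟩
  · exact ⟨y, h3 ▸ h, Le.refl _⟩

theorem mem_mono (R : SimRun A S τ e) {m m' : ℕ} (hm : m ≤ m') {p : Fin n} {y : SimData A}
    (h : R.mem m p = some y) : ∃ y', R.mem m' p = some y' ∧ Le y y' := by
  induction m', hm using Nat.le_induction with
  | base => exact ⟨y, h, Le.refl _⟩
  | succ k _ ih =>
    obtain ⟨y', h1, h2⟩ := ih
    obtain ⟨y'', h3, h4⟩ := R.mem_mono_succ h1
    exact ⟨y'', h3, h2.trans h4⟩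

theorem progress_mono (R : SimRun A S τ e) (j : Fin n) :
    Monotone fun m => progress (R.mem m) j := by
  intro m m' h
  refine progress_le fun q x hx => ?_
  obtain ⟨y, hy, hle⟩ := R.mem_mono h hx
  exact (hle.steps j).trans (steps_le_progress hy j)

theorem wins_eq_some {M : Fin n → Option (SimData A)} {j q : Fin n} {k : ℕ} {v : Proposal A} :
    wins M j k q = some v ↔ ∃ x, M q = some x ∧ x.won j k = some v := by
  simp [wins, Option.bind_eq_some_iff]

theorem wins_mono (R : SimRun A S τ e) {m m' : ℕ} (hm : m ≤ m') {j q : Fin n} {k : ℕ}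
    {v : Proposal A} (h : wins (R.mem m) j k q = some v) : wins (R.mem m') j k q = some v := by
  obtain ⟨x, hx, hw⟩ := wins_eq_some.1 h
  obtain ⟨y, hy, hle⟩ := R.mem_mono hm hx
  exact wins_eq_some.2 ⟨y, hy, hle.won j k v hw⟩

theorem hasWin_mono (R : SimRun A S τ e) {m m' : ℕ} (hm : m ≤ m') {j : Fin n} {k : ℕ}
    (h : HasWin (R.mem m) j k) : HasWin (R.mem m') j k := by
  obtain ⟨q, v, hv⟩ := h
  exact ⟨q, v, R.wins_mono hm hv⟩

theorem loc_won_of_wins (R : SimRun A S τ e) {m : ℕ} {j q : Fin n} {k : ℕ}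
    {v : Proposal A} (h : wins (R.mem m) j k q = some v) : (R.loc m q).won j k = some v := by
  obtain ⟨x, hx, hw⟩ := wins_eq_some.1 h
  exact (R.mem_le_loc hx).won j k v hw

theorem input_loc (R : SimRun A S τ e) (m : ℕ) (p : Fin n) :
    (R.loc m p).input = e.input p := by
  induction m with
  | zero => rw [R.loc_zero]; rfl
  | succ m ih =>
    rcases R.step_cases m p with ⟨-, -, h2, -⟩ | ⟨-, -, -, h2, -⟩ | ⟨-, -, -, h2, -⟩
    · rw [h2, ih]
    · rw [h2, ih]
    · rw [h2]; exact ih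

/-- A property of data that holds initially and is kept by updates holds for all data. -/
theorem loc_induction (R : SimRun A S τ e) (P : Fin n → SimData A → Prop)
    (h0 : ∀ p, P p (initial A (e.input p)))
    (h1 : ∀ m p x, P p x → P p (SimData.update S τ p x (R.mem m))) (m : ℕ) (p : Fin n) :
    P p (R.loc m p) := by
  induction m with
  | zero => rw [R.loc_zero]; exact h0 p
  | succ m ih =>
    rcases R.step_cases m p with ⟨-, -, h2, -⟩ | ⟨-, -, -, h2, -⟩ | ⟨-, -, -, h2, -⟩
    · rwa [h2]
    · rwa [h2]
    · rw [h2]; exact h1 m p _ ih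

/-- What is in a register was data of its owner before. -/
theorem exists_loc_of_mem (R : SimRun A S τ e) {m : ℕ} {p : Fin n} {y : SimData A}
    (h : R.mem m p = some y) : ∃ i < m, e.sched i = p ∧ y = R.loc i p := by
  induction m with
  | zero => simp [R.mem_zero] at h
  | succ m ih =>
    rcases R.step_cases m p with ⟨-, h1, h2, h3⟩ | ⟨hp, h0, h1, h2, h3⟩ | ⟨-, h0, h1, h2, h3⟩
    · obtain ⟨i, hi, h⟩ := ih (h3 ▸ h)
      exact ⟨i, by omega, h⟩
    · exact ⟨m, by omega, hp, Option.some.inj (h.symm.trans h3)⟩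
    · obtain ⟨i, hi, h⟩ := ih (h3 ▸ h)
      exact ⟨i, by omega, h⟩

/-- The snapshot that enters an agreement also records its step number as the number of completed
steps; the next snapshot replaces `entered`. -/
theorem entered_loc (R : SimRun A S τ e) {m : ℕ} {p j : Fin n} {k : ℕ}
    (h : (R.loc m p).entered = some (j, k)) : p ∈ S ∧ (R.loc m p).steps j = k := by
  refine R.loc_induction (fun p x => x.entered = some (j, k) → p ∈ S ∧ x.steps j = k)
    (fun p h => by simp [initial] at h) (fun m p x _ h => ?_) m p h
  simp only [SimData.update] at h ⊢
  split_ifs at h with hc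
  obtain ⟨rfl, rfl⟩ := Prod.mk.inj (Option.some.inj h)
  exact ⟨hc.1, by simp⟩

theorem entered_mem (R : SimRun A S τ e) {m : ℕ} {p j : Fin n} {k : ℕ} {y : SimData A}
    (hy : R.mem m p = some y) (h : y.entered = some (j, k)) : p ∈ S ∧ y.steps j = k := by
  obtain ⟨i, -, -, rfl⟩ := R.exists_loc_of_mem hy
  exact R.entered_loc h

/-- A winning proposal is made when none is seen. -/
theorem exists_of_loc_won (R : SimRun A S τ e) {m : ℕ} {p j : Fin n} {k : ℕ} {v : Proposal A}
    (h : (R.loc m p).won j k = some v) : ∃ i < m, e.sched i = p ∧ R.fresh i p = false ∧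
      (R.loc i p).entered = some (j, k) ∧ ¬ HasWin (R.mem i) j k ∧
      v = ⟨simMem (R.mem i), e.input p⟩ := by
  induction m with
  | zero => simp [R.loc_zero, initial] at h
  | succ m ih =>
    rcases R.step_cases m p with ⟨-, h1, h2, h3⟩ | ⟨hp, h0, h1, h2, h3⟩ | ⟨hp, h0, h1, h2, h3⟩
    · obtain ⟨i, hi, h⟩ := ih (h2 ▸ h)
      exact ⟨i, by omega, h⟩
    · obtain ⟨i, hi, h⟩ := ih (h2 ▸ h)
      exact ⟨i, by omega, h⟩
    · rw [h2] at h
      simp only [SimData.update] at h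
      split_ifs at h with hc
      · refine ⟨m, by omega, hp, h0, hc.1, hc.2, ?_⟩
        rw [← Option.some.inj h, R.input_loc]
      · obtain ⟨i, hi, h⟩ := ih h
        exact ⟨i, by omega, h⟩

/-- A process whose register lacks one of its winning proposals is about to write it. -/
theorem entered_of_unpublished (R : SimRun A S τ e) {m : ℕ} {p j : Fin n} {k : ℕ}
    (h : (R.loc m p).won j k ≠ wins (R.mem m) j k p) :
    ∃ y, R.mem m p = some y ∧ y.entered = some (j, k) := by
  induction m with
  | zero => simp [R.loc_zero, R.mem_zero, initial, wins] at h
  | succ m ih =>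
    rcases R.step_cases m p with ⟨-, h1, h2, h3⟩ | ⟨hp, h0, h1, h2, h3⟩ | ⟨hp, h0, h1, h2, h3⟩
    · simp only [wins, h3, h2] at h ⊢
      exact ih h
    · simp [wins, h2, h3] at h
    · have hM := R.mem_of_not_fresh h0
      rw [h3] at h ⊢
      refine ⟨_, hM, ?_⟩
      by_contra hne
      simp [h2, SimData.update, hne, wins, hM] at h

/-- Once a safe agreement is resolved, there are no new winning proposals. -/
theorem wins_eq_of_resolved (R : SimRun A S τ e) {i m : ℕ} {j : Fin n} {k : ℕ}
    (h : Resolved (R.mem i) j k) (hm : i ≤ m) (q : Fin n) :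
    wins (R.mem m) j k q = wins (R.mem i) j k q ∧
      (R.loc m q).won j k = wins (R.mem i) j k q := by
  induction m, hm using Nat.le_induction with
  | base =>
    refine ⟨rfl, ?_⟩
    by_contra hne
    -- An unpublished win would leave its owner visibly inside the agreement, so it would not be
    -- resolved.
    obtain ⟨y, hy, hy'⟩ := R.entered_of_unpublished hne
    exact h.2 q y hy hy'
  | succ m hm ih =>
    rcases R.step_cases m q with ⟨-, h1, h2, h3⟩ | ⟨hp, h0, h1, h2, h3⟩ | ⟨hp, h0, h1, h2, h3⟩
    · rw [h2]
      simp only [wins, h3] at ih ⊢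
      exact ih
    · rw [h2]
      refine ⟨?_, ih.2⟩
      rw [← ih.2]
      simp [wins, h3]
    · rw [h3, h2]
      refine ⟨ih.1, ?_⟩
      -- Late proposers see the published winner and therefore do not win.
      have := R.hasWin_mono hm h.1
      simpa [SimData.update, this] using ih.2

theorem wins_funext_of_resolved (R : SimRun A S τ e) {i m : ℕ} {j : Fin n} {k : ℕ}
    (h : Resolved (R.mem i) j k) (hm : i ≤ m) : wins (R.mem m) j k = wins (R.mem i) j k :=
  funext fun q => (R.wins_eq_of_resolved h hm q).1

/-- Only steps with resolved safe agreements are considered as completed. -/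
theorem resolved_of_lt_steps (R : SimRun A S τ e) {m : ℕ} {p j : Fin n} {k : ℕ}
    (h : k < (R.loc m p).steps j) : ∃ i < m, Resolved (R.mem i) j k := by
  induction m using Nat.strong_induction_on generalizing p with
  | _ m ih =>
  cases m with
  | zero => simp [R.loc_zero, initial] at h
  | succ m =>
    have prev : k < (R.loc m p).steps j → ∃ i < m + 1, Resolved (R.mem i) j k := fun hk => by
      obtain ⟨i, hi, hr⟩ := ih m (by omega) hk
      exact ⟨i, by omega, hr⟩
    rcases R.step_cases m p with ⟨-, h1, h2, h3⟩ | ⟨hp, h0, h1, h2, h3⟩ | ⟨hp, h0, h1, h2, h3⟩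
    · exact prev (h2 ▸ h)
    · exact prev (h2 ▸ h)
    · rw [h2] at h
      simp only [SimData.update] at h
      by_cases hj : j = τ ((R.loc m p).round + 1)
      · rw [← hj, Function.update_self] at h
        have low : k < progress (R.mem m) j → ∃ i < m + 1, Resolved (R.mem i) j k := fun hk => by
          obtain ⟨q, x, hx, hk⟩ := exists_of_lt_progress hk
          obtain ⟨i, hi, hr⟩ := ih m (by omega) (hk.trans_le ((R.mem_le_loc hx).steps j))
          exact ⟨i, by omega, hr⟩
        unfold nextStep at h
        split_ifs at h with hr
        · rcases Nat.lt_succ_iff_lt_or_eq.1 h with hk | rfl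
          · exact low hk
          · exact ⟨m, by omega, hr⟩
        · exact low h
      · rw [Function.update_of_ne hj] at h
        exact prev h

theorem resolved_of_lt_progress (R : SimRun A S τ e) {m : ℕ} {j : Fin n} {k : ℕ}
    (h : k < progress (R.mem m) j) : ∃ i < m, Resolved (R.mem i) j k := by
  obtain ⟨q, x, hx, hk⟩ := exists_of_lt_progress h
  exact R.resolved_of_lt_steps (hk.trans_le ((R.mem_le_loc hx).steps j))

/-- Progress beyond `k` would require step `k` to be resolved, hence a visible win; progress up to
`k` was published on entering. Thus a winning view reflects a memory in which exactly `k` steps of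
`j` are completed. -/
theorem progress_of_entered (R : SimRun A S τ e) {m : ℕ} {p j : Fin n} {k : ℕ}
    (hf : R.fresh m p = false) (h : (R.loc m p).entered = some (j, k))
    (hw : ¬ HasWin (R.mem m) j k) : progress (R.mem m) j = k := by
  apply le_antisymm
  · by_contra hk
    obtain ⟨i, hi, hr⟩ := R.resolved_of_lt_progress (not_le.1 hk)
    exact hw (R.hasWin_mono hi.le hr.1)
  · rw [← (R.entered_loc h).2]
    exact steps_le_progress (R.mem_of_not_fresh hf) j

/-- Winning proposals for a step are made when all earlier steps are completed. -/
theorem exists_progress_of_loc_won (R : SimRun A S τ e) {m : ℕ} {p j : Fin n} {k : ℕ}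
    {v : Proposal A} (h : (R.loc m p).won j k = some v) :
    ∃ i < m, progress (R.mem i) j = k := by
  obtain ⟨i, hi, -, hf, he, hw, -⟩ := R.exists_of_loc_won h
  exact ⟨i, hi, R.progress_of_entered hf he hw⟩

/-! ### The agreed results -/

open Classical in
/-- The agreed result of step `k` of process `j`, with the simulator that proposed it. -/
noncomputable def agreed (R : SimRun A S τ e) (j : Fin n) (k : ℕ) :
    Option (Fin n × Proposal A) :=
  if h : ∃ i, Resolved (R.mem i) j k then selected (wins (R.mem h.choose) j k) else none

/-- The selection depends only on the vector of winners, which is frozen from the first resolution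
on, so the choice of the witness time is immaterial. -/
theorem agreed_eq (R : SimRun A S τ e) {i m : ℕ} {j : Fin n} {k : ℕ}
    (h : Resolved (R.mem i) j k) (hm : i ≤ m) :
    R.agreed j k = selected (wins (R.mem m) j k) := by
  have h' : ∃ i, Resolved (R.mem i) j k := ⟨i, h⟩
  rw [agreed, dif_pos h']
  congr 1
  rw [← R.wins_funext_of_resolved h'.choose_spec (le_max_left _ m),
    R.wins_funext_of_resolved h hm, R.wins_funext_of_resolved h (hm.trans (le_max_right _ m))]

theorem exists_agreed (R : SimRun A S τ e) {i : ℕ} {j : Fin n} {k : ℕ}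
    (h : Resolved (R.mem i) j k) :
    ∃ z, R.agreed j k = some z ∧ wins (R.mem i) j k z.1 = some z.2 := by
  obtain ⟨q, v, hv⟩ := h.1
  obtain ⟨z, hz⟩ := exists_selected hv
  exact ⟨z, (R.agreed_eq h le_rfl).trans hz, selected_spec hz⟩

/-- The agreed result of step `k` of process `j`. -/
noncomputable def result (R : SimRun A S τ e) (j : Fin n) (k : ℕ) : Proposal A :=
  (R.agreed j k).elim ⟨fun _ => none, none⟩ Prod.snd

theorem decision_eq (R : SimRun A S τ e) {m : ℕ} {j : Fin n} {k : ℕ}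
    (h : k < progress (R.mem m) j) : decision (R.mem m) j k = R.result j k := by
  obtain ⟨i, hi, hr⟩ := R.resolved_of_lt_progress h
  rw [result, R.agreed_eq hr hi.le, decision]

/-- The input vector of the simulated execution. -/
noncomputable def simInput (R : SimRun A S τ e) : Vec n V := by
  classical
  exact fun j => if ∃ m, 0 < progress (R.mem m) j then (R.result j 0).input else none

/-- The simulated process `j` after `k` steps. -/
noncomputable def state (R : SimRun A S τ e) (j : Fin n) (k : ℕ) : A.State × Option A.Cell :=
  A.replay j (R.simInput j) (fun k => (R.result j k).view) k

/-- Only registers are compared: at `k = 0` the input of `j` may still be undecided, but the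
register is empty anyway. -/
theorem simState_eq (R : SimRun A S τ e) {m : ℕ} {j : Fin n} {k : ℕ}
    (h : k ≤ progress (R.mem m) j) : (simState (R.mem m) j k).2 = (R.state j k).2 := by
  rcases Nat.eq_zero_or_pos k with rfl | hk
  · rfl
  · have h0 : ∃ m, 0 < progress (R.mem m) j := ⟨m, by omega⟩
    rw [simState, state, simInput, if_pos h0, R.decision_eq (by omega)]
    congr 1
    exact A.replay_congr j _ fun l hl => by rw [R.decision_eq (by omega)]

theorem simMem_eq (R : SimRun A S τ e) (m : ℕ) :
    simMem (R.mem m) = fun j => (R.state j (progress (R.mem m) j)).2 :=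
  funext fun _ => R.simState_eq le_rfl

end SimRun

/-! ### Runs with idle steps -/

/-- A run with idle steps is, up to the idle steps, the run of an execution. -/
theorem Protocol.exists_schedule (A : Protocol n V W) (I : Vec n V) (o : ℕ → Option (Fin n))
    (C : ℕ → A.Config) (h0 : C 0 = ⟨fun p => A.init p (I p), fun _ => none⟩)
    (hidle : ∀ m, o m = none → C (m + 1) = C m)
    (hstep : ∀ m j, o m = some j → C (m + 1) = A.step (C m) j)
    (hinf : ∀ N, ∃ m ≥ N, o m ≠ none) :
    ∃ σ : ℕ → Fin n, (∀ m, ∃ i, A.run ⟨I, σ⟩ i = C m) ∧ (∀ i, ∃ m, A.run ⟨I, σ⟩ i = C m) ∧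
      (∀ j, (∃ k, σ k = j) ↔ ∃ m, o m = some j) ∧
      ∀ j, (∀ N, ∃ m ≥ N, o m = some j) → ∀ N, ∃ k, N ≤ k ∧ σ k = j := by
  classical
  have hinf' : {m | o m ≠ none}.Infinite :=
    Nat.frequently_atTop_iff_infinite.1 (Filter.frequently_atTop.2 hinf)
  have hsome : ∀ k, ∃ j, o (Nat.nth (fun m => o m ≠ none) k) = some j := fun k =>
    Option.ne_none_iff_exists'.1 (Nat.nth_mem_of_infinite hinf' k)
  choose σ hnth using hsome
  have hcn : ∀ k, Nat.count (fun m => o m ≠ none) (Nat.nth (fun m => o m ≠ none) k) = k :=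
    Nat.count_nth_of_infinite hinf'
  refine ⟨σ, ?_⟩
  have hcount : ∀ m j, o m = some j → σ (Nat.count (fun m => o m ≠ none) m) = j := by
    intro m j h
    have h1 := hnth (Nat.count (fun m => o m ≠ none) m)
    rw [Nat.nth_count (p := fun m => o m ≠ none) (by simp [h]), h] at h1
    exact (Option.some.inj h1).symm
  have hrun : ∀ m, A.run ⟨I, σ⟩ (Nat.count (fun m => o m ≠ none) m) = C m := by
    intro m
    induction m with
    | zero => rw [Nat.count_zero, h0]; rfl
    | succ m ih =>
      cases h : o m with
      | none => rw [Nat.count_succ, if_neg (by simp [h]), add_zero, ih, hidle m h]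
      | some j =>
        rw [Nat.count_succ, if_pos (by simp [h]), hstep m j h, ← ih, ← hcount m j h]
        rfl
  refine ⟨fun m => ⟨_, hrun m⟩, fun i => ⟨_, by rw [← hrun, hcn]⟩, fun j => ⟨?_, ?_⟩, ?_⟩
  · rintro ⟨k, rfl⟩
    exact ⟨_, hnth k⟩
  · rintro ⟨m, hm⟩
    exact ⟨_, hcount m j hm⟩
  · intro j hj N
    obtain ⟨m, hm, hmj⟩ := hj (Nat.nth (fun m => o m ≠ none) N)
    refine ⟨_, ?_, hcount m j hmj⟩
    calc N = _ := (hcn N).symm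
      _ ≤ _ := Nat.count_monotone _ hm

namespace SimRun

open SimData

variable {A : Protocol n V W} {S : Finset (Fin n)} {τ : ℕ → Fin n} {e : Execution n V}

/-! ### Linearization of the simulated steps -/

/-- The next step of the simulated process `j` is a snapshot that has been taken, with a result
that is not yet published. -/
def Early (R : SimRun A S τ e) (j : Fin n) (m : ℕ) : Prop :=
  -- This excludes agreed snapshots whose completion is never published, so that every linearized
  -- step gets completed and participation means positive progress.
  (∃ i, progress (R.mem m) j < progress (R.mem i) j) ∧
    (∃ f, A.act j (R.state j (progress (R.mem m) j)).1 = .snapshot f) ∧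
    ∃ z, R.agreed j (progress (R.mem m) j) = some z ∧
      (R.loc m z.1).won j (progress (R.mem m) j) ≠ none

open Classical in
/-- The number of steps of the simulated process `j` that are linearized before time `m`. -/
noncomputable def count (R : SimRun A S τ e) (j : Fin n) (m : ℕ) : ℕ :=
  progress (R.mem m) j + if R.Early j m then 1 else 0

theorem progress_le_count (R : SimRun A S τ e) (j : Fin n) (m : ℕ) :
    progress (R.mem m) j ≤ R.count j m := Nat.le_add_right _ _

theorem count_zero (R : SimRun A S τ e) (j : Fin n) : R.count j 0 = 0 := by
  have h0 : progress (R.mem 0) j = 0 :=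
    Nat.le_zero.1 (progress_le fun q x h => by simp [R.mem_zero] at h)
  rw [count, h0, if_neg]
  rintro ⟨-, -, z, -, hz⟩
  simp [R.loc_zero, initial] at hz

/-- A step counted early is a snapshot, which leaves the register of `j` alone. -/
theorem state_count_snd (R : SimRun A S τ e) (j : Fin n) (m : ℕ) :
    (R.state j (R.count j m)).2 = simMem (R.mem m) j := by
  rw [R.simMem_eq, count]
  split_ifs with h
  · obtain ⟨-, ⟨f, hf⟩, -⟩ := h
    change (A.localStep j (R.state j _) _).2 = _
    rw [Protocol.localStep, hf]
  · rfl

/-- Before each snapshot the local counts are already published, and the snapshot raises only the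
count of its current target. Hence one write can complete a step of one simulated process only. -/
theorem steps_loc_le (R : SimRun A S τ e) (m : ℕ) (p j : Fin n) :
    (R.loc m p).steps j ≤
      progress (R.mem m) j + if τ (R.loc m p).round = j then 1 else 0 := by
  induction m with
  | zero => simp [R.loc_zero, initial]
  | succ m ih =>
    have hmono : progress (R.mem m) j ≤ progress (R.mem (m + 1)) j :=
      R.progress_mono j (Nat.le_succ m)
    rcases R.step_cases m p with ⟨-, h1, h2, h3⟩ | ⟨hp, h0, h1, h2, h3⟩ | ⟨hp, h0, h1, h2, h3⟩
    · rw [h2]; omega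
    · rw [h2]; omega
    · rw [h2, h3]
      have hx := steps_le_progress (R.mem_of_not_fresh h0) j
      simp only [SimData.update]
      by_cases hj : j = τ ((R.loc m p).round + 1)
      · subst hj
        simp only [Function.update_self, if_true]
        unfold nextStep
        split_ifs <;> omega
      · rw [Function.update_of_ne hj]
        omega

theorem progress_write_le (R : SimRun A S τ e) {m : ℕ} (h : R.fresh m (e.sched m) = true)
    (j : Fin n) : progress (R.mem (m + 1)) j ≤
      max (progress (R.mem m) j) ((R.loc m (e.sched m)).steps j) := by
  refine progress_le fun q x hx => ?_
  rw [R.mem_write m h] at hx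
  by_cases hq : q = e.sched m
  · subst hq
    rw [Function.update_self] at hx
    rw [← Option.some.inj hx]
    exact le_max_right _ _
  · rw [Function.update_of_ne hq] at hx
    exact (steps_le_progress hx j).trans (le_max_left _ _)

theorem count_congr (R : SimRun A S τ e) {m m' : ℕ} {j : Fin n}
    (h : progress (R.mem m) j = progress (R.mem m') j) (h' : R.Early j m ↔ R.Early j m') :
    R.count j m = R.count j m' := by
  rw [count, count, h]
  by_cases hE : R.Early j m'
  · rw [if_pos hE, if_pos (h'.2 hE)]
  · rw [if_neg hE, if_neg fun hm => hE (h'.1 hm)]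

theorem early_congr (R : SimRun A S τ e) {m m' : ℕ} {j : Fin n}
    (h : progress (R.mem m) j = progress (R.mem m') j) (h' : R.loc m = R.loc m') :
    R.Early j m ↔ R.Early j m' := by
  simp only [Early, h, h']

/-- The effect of a write on the linearized steps. -/
theorem count_write (R : SimRun A S τ e) {m : ℕ} (h : R.fresh m (e.sched m) = true) :
    (∀ j, R.count j (m + 1) = R.count j m) ∨
      ∃ j, R.count j (m + 1) = R.count j m + 1 ∧
        (∀ j', j' ≠ j → R.count j' (m + 1) = R.count j' m) ∧
        A.localStep j (R.state j (R.count j m)) (simMem (R.mem m)) =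
          R.state j (R.count j m + 1) := by
  have hloc := R.loc_write m h
  have hmono : ∀ j, progress (R.mem m) j ≤ progress (R.mem (m + 1)) j := fun j =>
    R.progress_mono j (Nat.le_succ m)
  have same : ∀ j, progress (R.mem (m + 1)) j = progress (R.mem m) j →
      R.count j (m + 1) = R.count j m := fun j hj =>
    R.count_congr hj (R.early_congr hj hloc)
  set j := τ (R.loc m (e.sched m)).round with hj
  have other : ∀ j', j' ≠ j → R.count j' (m + 1) = R.count j' m := by
    intro j' hj'
    have h1 := R.steps_loc_le m (e.sched m) j'
    rw [if_neg fun h => hj' (h.symm.trans hj.symm)] at h1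
    have h2 := R.progress_write_le h j'
    exact same j' (le_antisymm (by omega) (hmono j'))
  by_cases hp : progress (R.mem (m + 1)) j = progress (R.mem m) j
  · left
    intro j'
    by_cases hj' : j' = j
    · rw [hj']; exact same j hp
    · exact other j' hj'
  have hp1 : progress (R.mem (m + 1)) j = progress (R.mem m) j + 1 := by
    have h1 := R.steps_loc_le m (e.sched m) j
    rw [if_pos hj.symm] at h1
    have h2 := R.progress_write_le h j
    have h3 := hmono j
    omega
  -- Wins for the following step can only be made after this progress is published.
  have hnot : ¬ R.Early j (m + 1) := by
    rintro ⟨-, -, z, -, hz⟩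
    obtain ⟨v, hv⟩ := Option.ne_none_iff_exists'.1 hz
    obtain ⟨i, hi, hik⟩ := R.exists_progress_of_loc_won hv
    have : progress (R.mem i) j ≤ progress (R.mem m) j := R.progress_mono j (by omega)
    omega
  have hc1 : R.count j (m + 1) = progress (R.mem m) j + 1 := by
    rw [count, if_neg hnot, hp1, add_zero]
  cases hact : A.act j (R.state j (progress (R.mem m) j)).1 with
  | write c s =>
    right
    have hc : R.count j m = progress (R.mem m) j := by
      rw [count, if_neg, add_zero]
      rintro ⟨-, ⟨f, hf⟩, -⟩
      rw [hact] at hf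
      cases hf
    refine ⟨j, by rw [hc, hc1], other, ?_⟩
    rw [hc]
    change _ = A.localStep j (R.state j _) _
    -- A write ignores the view, so the agreed view need not match the present memory.
    simp only [Protocol.localStep, hact]
  | snapshot f =>
    left
    -- A snapshot was counted when its selected proposal was made, so publishing its completion
    -- changes nothing.
    have hc : R.count j m = progress (R.mem m) j + 1 := by
      rw [count, if_pos]
      refine ⟨⟨m + 1, by omega⟩, ⟨f, hact⟩, ?_⟩
      obtain ⟨i, hi, hr⟩ := R.resolved_of_lt_progress
        (show progress (R.mem m) j < progress (R.mem (m + 1)) j by omega)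
      obtain ⟨z, hz, hw⟩ := R.exists_agreed hr
      refine ⟨z, hz, ?_⟩
      rw [R.loc_won_of_wins (R.wins_mono (Nat.lt_succ_iff.1 hi) hw)]
      simp
    intro j'
    by_cases hj' : j' = j
    · rw [hj', hc, hc1]
    · exact other j' hj'

/-- A simulated snapshot is linearized when its agreed result is taken. -/
theorem agreed_of_early_succ (R : SimRun A S τ e) {m : ℕ} {j : Fin n}
    (h : R.fresh m (e.sched m) = false) (h1 : R.Early j (m + 1)) (h0 : ¬ R.Early j m) :
    (R.loc m (e.sched m)).entered = some (j, progress (R.mem m) j) ∧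
      (R.result j (progress (R.mem m) j)).view = simMem (R.mem m) := by
  have hmem := R.mem_snapshot m h
  obtain ⟨⟨i, hi⟩, hf, z, hz, hw⟩ := h1
  rw [hmem] at hi hf hz hw
  have hw0 : (R.loc m z.1).won j (progress (R.mem m) j) = none := by
    by_contra hne
    exact h0 ⟨⟨i, hi⟩, hf, z, hz, hne⟩
  obtain ⟨i', hi', hr⟩ := R.resolved_of_lt_progress hi
  rcases R.step_cases m z.1 with ⟨-, -, h2, -⟩ | ⟨-, -, -, h2, -⟩ | ⟨hp, -, -, h2, -⟩
  · exact absurd (h2 ▸ hw0) hw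
  · exact absurd (h2 ▸ hw0) hw
  · rw [hp]
    by_cases hc : (R.loc m z.1).entered = some (j, progress (R.mem m) j) ∧
        ¬ HasWin (R.mem m) j (progress (R.mem m) j)
    · refine ⟨hc.1, ?_⟩
      have hv : (R.loc (m + 1) z.1).won j (progress (R.mem m) j) =
          some ⟨simMem (R.mem m), (R.loc m z.1).input⟩ := by
        rw [h2]
        simp only [SimData.update]
        rw [if_pos hc]
      obtain ⟨z', hz', hwz⟩ := R.exists_agreed hr
      rw [hz] at hz'
      obtain rfl := Option.some.inj hz'
      -- The proposal made now and the agreed one have the same author; both persist to a common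
      -- later time and so coincide.
      have e1 := (R.loc_le (le_max_left (m + 1) i') z.1).won _ _ _ hv
      have e2 := (R.loc_le (le_max_right (m + 1) i') z.1).won _ _ _ (R.loc_won_of_wins hwz)
      have e3 := Option.some.inj (e2.symm.trans e1)
      rw [result, hz]
      simp [e3]
    · rw [h2] at hw
      simp only [SimData.update] at hw
      rw [if_neg hc] at hw
      exact absurd hw0 hw

/-- The effect of a snapshot on the linearized steps. -/
theorem count_snapshot (R : SimRun A S τ e) {m : ℕ} (h : R.fresh m (e.sched m) = false) :
    (∀ j, R.count j (m + 1) = R.count j m) ∨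
      ∃ j, R.count j (m + 1) = R.count j m + 1 ∧
        (∀ j', j' ≠ j → R.count j' (m + 1) = R.count j' m) ∧
        A.localStep j (R.state j (R.count j m)) (simMem (R.mem m)) =
          R.state j (R.count j m + 1) := by
  have hmem := R.mem_snapshot m h
  have mono : ∀ j, R.Early j m → R.Early j (m + 1) := by
    rintro j ⟨hi, hf, z, hz, hw⟩
    rw [Early, hmem]
    refine ⟨hi, hf, z, hz, ?_⟩
    obtain ⟨v, hv⟩ := Option.ne_none_iff_exists'.1 hw
    rw [(R.loc_le_succ m z.1).won _ _ _ hv]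
    simp
  have same : ∀ j, (R.Early j (m + 1) → R.Early j m) → R.count j (m + 1) = R.count j m :=
    fun j hj => R.count_congr (by rw [hmem]) ⟨hj, mono j⟩
  by_cases hex : ∃ j, R.Early j (m + 1) ∧ ¬ R.Early j m
  · right
    obtain ⟨j, h1, h0⟩ := hex
    obtain ⟨he, hv⟩ := R.agreed_of_early_succ h h1 h0
    have hc : R.count j m = progress (R.mem m) j := by rw [count, if_neg h0, add_zero]
    refine ⟨j, ?_, fun j' hj' => same j' fun h1' => ?_, ?_⟩
    · rw [hc, count, if_pos h1, hmem]
    · by_contra h0'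
      -- The simulator is inside a single agreement, so one real snapshot linearizes at most one
      -- simulated step.
      obtain ⟨he', -⟩ := R.agreed_of_early_succ h h1' h0'
      rw [he] at he'
      exact hj' (Prod.mk.inj (Option.some.inj he')).1.symm
    · rw [hc, ← hv]
      rfl
  · left
    intro j
    exact same j fun h1 => by
      by_contra h0
      exact hex ⟨j, h1, h0⟩

theorem exists_linearization (R : SimRun A S τ e) : ∃ o : ℕ → Option (Fin n), ∀ m,
    (∀ j, o m ≠ some j → R.count j (m + 1) = R.count j m) ∧
    ∀ j, o m = some j → R.count j (m + 1) = R.count j m + 1 ∧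
      A.localStep j (R.state j (R.count j m)) (simMem (R.mem m)) =
        R.state j (R.count j m + 1) := by
  rw [← Classical.skolem (p := fun m (a : Option (Fin n)) =>
    (∀ j, a ≠ some j → R.count j (m + 1) = R.count j m) ∧
    ∀ j, a = some j → R.count j (m + 1) = R.count j m + 1 ∧
      A.localStep j (R.state j (R.count j m)) (simMem (R.mem m)) =
        R.state j (R.count j m + 1))]
  intro m
  have := by
    cases hf : R.fresh m (e.sched m) with
    | true => exact R.count_write hf
    | false => exact R.count_snapshot hf
  rcases this with h | ⟨j, h1, h2, h3⟩
  · exact ⟨none, fun j _ => h j, fun j hj => by cases hj⟩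
  · refine ⟨some j, fun j' hj' => h2 j' fun hh => hj' (by rw [hh]), fun j' hj' => ?_⟩
    obtain rfl := Option.some.inj hj'
    exact ⟨h1, h3⟩

/-- The configuration of the simulated execution at time `m`. -/
noncomputable def config (R : SimRun A S τ e) (m : ℕ) : A.Config :=
  ⟨fun j => (R.state j (R.count j m)).1, fun j => (R.state j (R.count j m)).2⟩

/-- If some simulated process takes infinitely many steps, the simulation yields an execution
of the simulated protocol. -/
theorem exists_execution (R : SimRun A S τ e)
    (hinf : ∃ j, ∀ N, ∃ m, N < progress (R.mem m) j) :
    ∃ e' : Execution n V, e'.input = R.simInput ∧ (∀ m, ∃ i, A.run e' i = R.config m) ∧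
      (∀ i, ∃ m, A.run e' i = R.config m) ∧
      (∀ j, j ∈ e'.participating ↔ ∃ m, 0 < progress (R.mem m) j) ∧
      ∀ j, (∀ N, ∃ m, N < progress (R.mem m) j) → j ∈ e'.correct := by
  obtain ⟨o, ho⟩ := R.exists_linearization
  have changed : ∀ j N m, N ≤ m → R.count j m ≠ R.count j N → ∃ i ≥ N, o i = some j := by
    intro j N m hm hne
    by_contra! hno
    apply hne
    induction m, hm using Nat.le_induction with
    | base => rfl
    | succ m hm ih =>
      rw [(ho m).1 j (hno m hm)]
      by_contra hne'
      exact hne' (ih hne')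
  have infinite : ∀ j, (∀ N, ∃ m, N < progress (R.mem m) j) → ∀ N, ∃ m ≥ N, o m = some j := by
    intro j hj N
    obtain ⟨m, hm⟩ := hj (R.count j N)
    have hle : N ≤ m := by
      by_contra hlt
      have h1 : progress (R.mem m) j ≤ progress (R.mem N) j := R.progress_mono j (by omega)
      have h2 := R.progress_le_count j N
      omega
    have := R.progress_le_count j m
    exact changed j N m hle (by omega)
  have hsched := A.exists_schedule R.simInput o R.config ?_ ?_ ?_ ?_
  · obtain ⟨σ, h1, h2, h3, h4⟩ := hsched
    refine ⟨⟨R.simInput, σ⟩, rfl, h1, h2, fun j => (h3 j).trans ⟨?_, ?_⟩, fun j hj =>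
      h4 j (infinite j hj)⟩
    · rintro ⟨m, hm⟩
      have hc := ((ho m).2 j hm).1
      by_cases hE : R.Early j (m + 1)
      · obtain ⟨⟨i, hi⟩, -⟩ := hE
        exact ⟨i, by omega⟩
      · rw [count, if_neg hE] at hc
        exact ⟨m + 1, by omega⟩
    · rintro ⟨m, hm⟩
      have := R.progress_le_count j m
      obtain ⟨i, -, hi⟩ := changed j 0 m (Nat.zero_le _) (by rw [R.count_zero]; omega)
      exact ⟨i, hi⟩
  · simp only [config, R.count_zero]
    rfl
  · intro m hm
    have : ∀ j, R.count j (m + 1) = R.count j m := fun j => (ho m).1 j (by simp [hm])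
    simp only [config, this]
  · intro m j hm
    obtain ⟨hc, hs⟩ := (ho m).2 j hm
    have hview : (R.config m).mem = simMem (R.mem m) := funext fun j => R.state_count_snd j m
    have hpair : ((R.config m).loc j, simMem (R.mem m) j) = R.state j (R.count j m) := by
      rw [← R.state_count_snd]
      rfl
    rw [Protocol.step_eq, hview, hpair, hs, ← hview, ← hc]
    simp only [config]
    congr 1
    all_goals
      funext j'
      by_cases hj' : j' = j
      · subst hj'; simp
      · rw [Function.update_of_ne hj', (ho m).1 j' (by simpa [hm] using fun h => hj' h.symm)]
  · intro N
    obtain ⟨j, hj⟩ := hinf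
    obtain ⟨m, hm, h⟩ := infinite j hj N
    exact ⟨m, hm, by simp [h]⟩

end SimRun

namespace SimRun

open SimData

variable {A : Protocol n V W} {S : Finset (Fin n)} {τ : ℕ → Fin n} {e : Execution n V}

/-! ### Progress of the simulation -/

theorem exists_next_step (R : SimRun A S τ e) {p : Fin n} (hp : p ∈ e.correct) (N : ℕ) :
    ∃ m ≥ N, e.sched m = p ∧ R.loc m p = R.loc N p ∧ R.fresh m p = R.fresh N p := by
  classical
  have hex := hp N
  obtain ⟨h1, h2⟩ := Nat.find_spec hex
  refine ⟨Nat.find hex, h1, h2, ?_⟩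
  have key : ∀ i, N ≤ i → i ≤ Nat.find hex →
      R.loc i p = R.loc N p ∧ R.fresh i p = R.fresh N p := by
    intro i hi
    induction i, hi using Nat.le_induction with
    | base => exact fun _ => ⟨rfl, rfl⟩
    | succ i hi ih =>
      intro hlt
      have hne : e.sched i ≠ p := fun h => Nat.find_min hex (m := i) (by omega) ⟨hi, h⟩
      rw [R.loc_of_ne hne, R.fresh_of_ne hne]
      exact ih (by omega)
  exact key _ h1 le_rfl

theorem exists_next_write (R : SimRun A S τ e) {p : Fin n} (hp : p ∈ e.correct) {N : ℕ}
    (hf : R.fresh N p = true) : ∃ m ≥ N, R.fresh m p = false ∧ R.loc m p = R.loc N p ∧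
      R.mem m p = some (R.loc N p) := by
  obtain ⟨m, hm, hs, hl, hf'⟩ := R.exists_next_step hp N
  rcases R.step_cases m p with ⟨h0, -⟩ | ⟨-, -, h1, h2, h3⟩ | ⟨-, h0, -⟩
  · exact absurd hs h0
  · exact ⟨m + 1, by omega, h1, h2.trans hl, h3.trans (by rw [hl])⟩
  · simp [hf', hf] at h0

/-- The number of steps of process `p`, as seen from its data. -/
def clock (R : SimRun A S τ e) (p : Fin n) (m : ℕ) : ℕ :=
  2 * (R.loc m p).round + if R.fresh m p then 0 else 1

theorem clock_succ (R : SimRun A S τ e) {p : Fin n} {m : ℕ} (h : e.sched m = p) :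
    R.clock p (m + 1) = R.clock p m + 1 := by
  rcases R.step_cases m p with ⟨h0, -⟩ | ⟨-, h0, h1, h2, h3⟩ | ⟨-, h0, h1, h2, h3⟩
  · exact absurd h h0
  · simp [clock, h0, h1, h2]
  · simp [clock, h0, h1, h2, SimData.update]
    ring

theorem exists_clock_eq (R : SimRun A S τ e) {p : Fin n} (hp : p ∈ e.correct) (N v : ℕ)
    (hv : R.clock p N ≤ v) : ∃ m ≥ N, e.sched m = p ∧ R.clock p m = v := by
  induction v, hv using Nat.le_induction with
  | base =>
    obtain ⟨m, hm, hs, hl, hf⟩ := R.exists_next_step hp N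
    exact ⟨m, hm, hs, by rw [clock, clock, hl, hf]⟩
  | succ v _ ih =>
    obtain ⟨m, hm, hs, hc⟩ := ih
    obtain ⟨m', hm', hs', hl, hf⟩ := R.exists_next_step hp (m + 1)
    refine ⟨m', by omega, hs', ?_⟩
    rw [← hc, ← R.clock_succ hs, clock, clock, hl, hf]

/-- A correct process turns to each simulated process infinitely often. -/
theorem exists_snapshot (R : SimRun A S τ e) (hτ : ∀ j N, ∃ r ≥ N, τ r = j) {p : Fin n}
    (hp : p ∈ e.correct) (j : Fin n) (N : ℕ) : ∃ m ≥ N, R.fresh m p = false ∧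
      R.fresh (m + 1) p = true ∧ τ ((R.loc m p).round + 1) = j ∧
      R.loc (m + 1) p = SimData.update S τ p (R.loc m p) (R.mem m) := by
  obtain ⟨r, hr, hj⟩ := hτ j (R.clock p N + 1)
  -- An odd clock value means that a snapshot is due; `2 * r - 1` is the one that raises the round
  -- from `r - 1` to `r`.
  obtain ⟨m, hm, hs, hc⟩ := R.exists_clock_eq hp N (2 * r - 1) (by omega)
  have hround : (R.loc m p).round + 1 = r := by
    unfold clock at hc
    split_ifs at hc <;> omega
  rcases R.step_cases m p with ⟨h0, -⟩ | ⟨-, h0, -⟩ | ⟨-, h0, h1, h2, -⟩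
  · exact absurd hs h0
  · simp only [clock, h0, if_true] at hc
    omega
  · exact ⟨m, hm, h0, h1, by rw [hround, hj], h2⟩

theorem entered_update_ne {M : Fin n → Option (SimData A)} {j : Fin n} {k : ℕ}
    (h : HasWin M j k) (p : Fin n) (x : SimData A) :
    (SimData.update S τ p x M).entered ≠ some (j, k) := by
  intro he
  simp only [SimData.update] at he
  split_ifs at he with hc
  obtain ⟨rfl, rfl⟩ := Prod.mk.inj (Option.some.inj he)
  exact hc.2 h

/-- A simulator that is correct does not block a safe agreement that has a winning proposal. -/
theorem eventually_not_entered (R : SimRun A S τ e) (hτ : ∀ j N, ∃ r ≥ N, τ r = j)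
    {q : Fin n} (hq : q ∈ e.correct) {j : Fin n} {k N : ℕ} (h : HasWin (R.mem N) j k) :
    ∃ N', ∀ m ≥ N', ∀ y, R.mem m q = some y → y.entered ≠ some (j, k) := by
  obtain ⟨m, hm, -, hf, -, hl⟩ := R.exists_snapshot hτ hq j N
  obtain ⟨m', hm', -, hl', hM⟩ := R.exists_next_write hq hf
  have hclean : (R.loc (m + 1) q).entered ≠ some (j, k) := by
    rw [hl]
    exact entered_update_ne (R.hasWin_mono hm h) q _
  suffices ∀ i ≥ m', (R.loc i q).entered ≠ some (j, k) ∧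
      ∀ y, R.mem i q = some y → y.entered ≠ some (j, k) from ⟨m', fun i hi => (this i hi).2⟩
  intro i hi
  induction i, hi using Nat.le_induction with
  | base =>
    refine ⟨hl' ▸ hclean, fun y hy => ?_⟩
    rw [hM] at hy
    exact Option.some.inj hy ▸ hclean
  | succ i hi ih =>
    rcases R.step_cases i q with ⟨-, -, h2, h3⟩ | ⟨-, -, -, h2, h3⟩ | ⟨-, -, -, h2, h3⟩
    · rw [h2, h3]
      exact ih
    · rw [h2, h3]
      exact ⟨ih.1, fun y hy => Option.some.inj hy ▸ ih.1⟩
    · rw [h2, h3]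
      exact ⟨entered_update_ne (R.hasWin_mono (by omega) h) q _, ih.2⟩

theorem exists_stable_progress (R : SimRun A S τ e) {j : Fin n}
    (hb : ∃ B, ∀ m, progress (R.mem m) j ≤ B) :
    ∃ N k, (∀ m, progress (R.mem m) j ≤ k) ∧ ∀ m ≥ N, progress (R.mem m) j = k := by
  classical
  have hk := Nat.find_spec hb
  have : ∃ N, progress (R.mem N) j = Nat.find hb := by
    by_contra! hne
    have hlt : ∀ m, progress (R.mem m) j < Nat.find hb := fun m =>
      lt_of_le_of_ne (hk m) (hne m)
    have h0 := hlt 0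
    exact Nat.find_min hb (m := Nat.find hb - 1) (by omega) fun m => by
      have := hlt m
      omega
  obtain ⟨N, hN⟩ := this
  exact ⟨N, _, hk, fun m hm => le_antisymm (hk m) (hN ▸ R.progress_mono j hm)⟩

/-- A correct process eventually publishes what it knows, so bounds on the published progress apply
to it. -/
theorem steps_loc_le_of_correct (R : SimRun A S τ e) {p j : Fin n} (hp : p ∈ e.correct) {k : ℕ}
    (hk : ∀ m, progress (R.mem m) j ≤ k) (m : ℕ) : (R.loc m p).steps j ≤ k := by
  cases hf : R.fresh m p with
  | false => exact (steps_le_progress (R.mem_of_not_fresh hf) j).trans (hk m)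
  | true =>
    obtain ⟨m', -, -, -, hM⟩ := R.exists_next_write hp hf
    exact (steps_le_progress hM j).trans (hk m')

/-- If a simulated process takes finitely many steps only, then a faulty simulator has stopped
in the middle of proposing for it. -/
theorem exists_blocking (R : SimRun A S τ e) (hτ : ∀ j N, ∃ r ≥ N, τ r = j) {p : Fin n}
    (hpS : p ∈ S) (hp : p ∈ e.correct) {j : Fin n} (hb : ∃ B, ∀ m, progress (R.mem m) j ≤ B) :
    ∃ q ∈ S, q ≠ p ∧ ∃ N k, ∀ m ≥ N, ∃ y, R.mem m q = some y ∧ y.entered = some (j, k) := by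
  obtain ⟨N, k, hk, hN⟩ := R.exists_stable_progress hb
  have stuck : ∀ m ≥ N, τ ((R.loc m p).round + 1) = j →
      R.loc (m + 1) p = SimData.update S τ p (R.loc m p) (R.mem m) →
      ¬ Resolved (R.mem m) j k ∧ nextStep (R.mem m) j = k := by
    intro m hm hj hl
    have h1 := R.steps_loc_le_of_correct hp hk (m + 1)
    rw [hl] at h1
    simp only [SimData.update, hj, Function.update_self] at h1
    have h2 := hN m hm
    unfold nextStep at h1 ⊢
    rw [h2] at h1 ⊢
    split_ifs at h1 ⊢ with hr
    · omega
    · exact ⟨hr, rfl⟩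
  -- Otherwise `p` would enter at its next visit to `j`, see no winner at its following snapshot,
  -- and win.
  have hwin : ∃ m, HasWin (R.mem m) j k := by
    by_contra hno
    have hno : ∀ m, ¬ HasWin (R.mem m) j k := fun m hm => hno ⟨m, hm⟩
    obtain ⟨m, hm, -, hf, hj, hl⟩ := R.exists_snapshot hτ hp j N
    obtain ⟨-, hnext⟩ := stuck m hm hj hl
    have he : (R.loc (m + 1) p).entered = some (j, k) := by
      rw [hl]
      simp only [SimData.update]
      rw [if_pos ⟨hpS, by rw [hj, hnext]; exact hno m⟩, hj, hnext]
    obtain ⟨m2, hm2, hf2, hl2, -⟩ := R.exists_next_write hp hf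
    obtain ⟨m3, hm3, hs3, hl3, hf3⟩ := R.exists_next_step hp m2
    rcases R.step_cases m3 p with ⟨h0, -⟩ | ⟨-, h0, -⟩ | ⟨-, h0, h1, h2, -⟩
    · exact h0 hs3
    · rw [hf3, hf2] at h0
      cases h0
    · have hw : (R.loc (m3 + 1) p).won j k =
          some ⟨simMem (R.mem m3), (R.loc m3 p).input⟩ := by
        rw [h2]
        simp only [SimData.update]
        rw [if_pos ⟨by rw [hl3, hl2, he], hno m3⟩]
      obtain ⟨m4, -, -, -, hM⟩ := R.exists_next_write hp h1
      exact hno m4 ⟨p, _, wins_eq_some.2 ⟨_, hM, hw⟩⟩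
  obtain ⟨N1, hN1⟩ := hwin
  by_contra hno
  -- Without a blocker every register eventually leaves the agreement for good; as a winner is
  -- visible, the next visit of `p` to `j` would find it resolved.
  have quiet : ∀ q, ∃ N', ∀ m ≥ N', ∀ y, R.mem m q = some y → y.entered ≠ some (j, k) := by
    intro q
    by_cases hq : q ∈ e.correct
    · exact R.eventually_not_entered hτ hq hN1
    · obtain ⟨N3, hN3⟩ : ∃ N3, ∀ m ≥ N3, e.sched m ≠ q := by
        simpa [Execution.correct] using hq
      have hconst : ∀ m ≥ N3, R.mem m q = R.mem N3 q := by
        intro m hm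
        induction m, hm using Nat.le_induction with
        | base => rfl
        | succ m hm ih => rw [R.mem_of_ne (hN3 m hm), ih]
      refine ⟨N3, fun m hm y hy he => hno ⟨q, (R.entered_mem hy he).1, ?_, N3, k, ?_⟩⟩
      · rintro rfl
        exact hq hp
      · intro m' hm'
        exact ⟨y, by rw [hconst m' hm', ← hconst m hm, hy], he⟩
  choose N' hN' using quiet
  obtain ⟨m, hm, -, -, hj, hl⟩ :=
    R.exists_snapshot hτ hp j (max (max N N1) (Finset.univ.sup N'))
  have hm1 : N ≤ m ∧ N1 ≤ m ∧ Finset.univ.sup N' ≤ m := by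
    simpa [and_assoc] using hm
  refine (stuck m hm1.1 hj hl).1 ⟨R.hasWin_mono hm1.2.1 hN1, fun q => hN' q m ?_⟩
  exact (Finset.le_sup (Finset.mem_univ q)).trans hm1.2.2

/-- At most `t` of the simulated processes take finitely many steps only, when one of `t + 1`
simulators is correct. -/
theorem ncard_infinite (R : SimRun A S τ e) (hτ : ∀ j N, ∃ r ≥ N, τ r = j) {p : Fin n}
    (hpS : p ∈ S) (hp : p ∈ e.correct) {t : ℕ} (ht : S.card = t + 1) :
    n ≤ {j | ∀ N, ∃ m, N < progress (R.mem m) j}.ncard + t := by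
  classical
  set U := {j | ∀ N, ∃ m, N < progress (R.mem m) j} with hU
  have hblock : ∀ j : ↥(Uᶜ), ∃ q ∈ S, q ≠ p ∧
      ∃ N k, ∀ m ≥ N, ∃ y, R.mem m q = some y ∧ y.entered = some (j.1, k) := by
    rintro ⟨j, hj⟩
    refine R.exists_blocking hτ hpS hp ?_
    simpa [hU] using hj
  choose f hfS hfp N k hf using hblock
  -- At a time late enough for both, the register of a common blocker holds a single `entered` pair,
  -- which names both processes.
  have hinj : Function.Injective fun j => (⟨f j, Finset.mem_erase.2 ⟨hfp j, hfS j⟩⟩ :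
      ↥(S.erase p)) := by
    intro j j' hjj
    have hjj' : f j = f j' := congrArg Subtype.val hjj
    obtain ⟨y, hy, he⟩ := hf j (max (N j) (N j')) (le_max_left _ _)
    obtain ⟨y', hy', he'⟩ := hf j' (max (N j) (N j')) (le_max_right _ _)
    rw [hjj', hy'] at hy
    rw [← Option.some.inj hy, he'] at he
    exact Subtype.ext (Prod.mk.inj (Option.some.inj he)).1.symm
  have hcard := Nat.card_le_card_of_injective _ hinj
  rw [Nat.card_coe_set_eq, Nat.card_eq_fintype_card, Fintype.card_coe,
    Finset.card_erase_of_mem hpS, ht] at hcard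
  have hsum := Set.ncard_add_ncard_compl U
  rw [Nat.card_eq_fintype_card, Fintype.card_fin] at hsum
  omega

/-! ### Inputs and outputs of the simulation -/

theorem simInput_eq_none (R : SimRun A S τ e) {j : Fin n}
    (h : ¬ ∃ m, 0 < progress (R.mem m) j) : R.simInput j = none := if_neg h

/-- The agreed input of `j` is that of the simulator whose proposal was selected for step 0, and a
proposer has taken steps. -/
theorem simInput_eq (R : SimRun A S τ e) {j : Fin n} (h : ∃ m, 0 < progress (R.mem m) j) :
    ∃ q ∈ e.participating, R.simInput j = e.input q := by
  rw [simInput, if_pos h]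
  obtain ⟨m, hm⟩ := h
  obtain ⟨i, -, hr⟩ := R.resolved_of_lt_progress hm
  obtain ⟨z, hz, hw⟩ := R.exists_agreed hr
  obtain ⟨i', -, hp, -, -, -, hv⟩ := R.exists_of_loc_won (R.loc_won_of_wins hw)
  refine ⟨z.1, ⟨i', hp⟩, ?_⟩
  rw [result, hz]
  simp [hv]

theorem hasOutput_mono (R : SimRun A S τ e) {m m' : ℕ} (h : m ≤ m') {w : W}
    (hw : HasOutput (R.mem m) w) : HasOutput (R.mem m') w := by
  obtain ⟨j, k, c, q, hk, hc, ho⟩ := hw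
  have hk' : k ≤ progress (R.mem m') j := hk.trans (R.progress_mono j h)
  exact ⟨j, k, c, q, hk', by rw [R.simState_eq hk', ← R.simState_eq hk, hc], ho⟩

/-- The count starts at 0 and grows by at most one at a time, so each intermediate state of `j`
occurs in the simulated execution, including contents overwritten later. -/
theorem exists_count_eq (R : SimRun A S τ e) {j : Fin n} {k m : ℕ} (h : k ≤ R.count j m) :
    ∃ i, R.count j i = k := by
  obtain ⟨o, ho⟩ := R.exists_linearization
  induction m with
  | zero =>
    rw [R.count_zero] at h
    exact ⟨0, by rw [R.count_zero]; omega⟩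
  | succ m ih =>
    by_cases hk : k ≤ R.count j m
    · exact ih hk
    · refine ⟨m + 1, ?_⟩
      by_cases hj : o m = some j
      · have := ((ho m).2 j hj).1
        omega
      · have := (ho m).1 j hj
        omega

theorem hasOutput_iff (R : SimRun A S τ e) {w : W} : (∃ m, HasOutput (R.mem m) w) ↔
    ∃ m j c q, (R.config m).mem j = some c ∧ A.out c q = some w := by
  constructor
  · rintro ⟨m, j, k, c, q, hk, hc, ho⟩
    obtain ⟨i, hi⟩ := R.exists_count_eq (hk.trans (R.progress_le_count j m))
    refine ⟨i, j, c, q, ?_, ho⟩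
    rw [R.simState_eq hk] at hc
    simp only [config, hi, hc]
  · rintro ⟨m, j, c, q, hc, ho⟩
    exact ⟨m, j, _, c, q, le_rfl, (R.state_count_snd j m).symm.trans hc, ho⟩

/-- Adoption tags a value with the adopter, so outputs for a process occur only in its own register;
this is what makes them unique. -/
theorem output_loc (R : SimRun A S τ e) {m : ℕ} {p q : Fin n} {w : W}
    (h : (R.loc m p).output = some (q, w)) : q = p ∧ ∃ i, HasOutput (R.mem i) w := by
  refine R.loc_induction (fun p x => ∀ q w, x.output = some (q, w) →
    q = p ∧ ∃ i, HasOutput (R.mem i) w) (fun p q w h => by simp [initial] at h)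
    (fun m p x ih q w h => ?_) m p q w h
  simp only [SimData.update] at h
  cases hx : x.output with
  | some z =>
    rw [hx, Option.some_or] at h
    exact ih q w (hx.trans h)
  | none =>
    rw [hx, Option.none_or] at h
    split_ifs at h with hw
    obtain ⟨rfl, rfl⟩ := Prod.mk.inj (Option.some.inj h)
    exact ⟨rfl, m, hw.choose_spec⟩

theorem output_mem (R : SimRun A S τ e) {m : ℕ} {p q : Fin n} {w : W} {y : SimData A}
    (hy : R.mem m p = some y) (h : y.output = some (q, w)) :
    q = p ∧ p ∈ e.participating ∧ ∃ i, HasOutput (R.mem i) w := by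
  obtain ⟨i, -, hi, rfl⟩ := R.exists_loc_of_mem hy
  obtain ⟨h1, h2⟩ := R.output_loc h
  exact ⟨h1, ⟨i, hi⟩, h2⟩

/-- Correct processes adopt an output value. -/
theorem exists_output (R : SimRun A S τ e) (hτ : ∀ j N, ∃ r ≥ N, τ r = j) {p : Fin n}
    (hp : p ∈ e.correct) {w : W} {N : ℕ} (hw : HasOutput (R.mem N) w) :
    ∃ m y w', R.mem m p = some y ∧ y.output = some (p, w') := by
  obtain ⟨m, hm, -, hf, -, hl⟩ := R.exists_snapshot hτ hp p N
  obtain ⟨m', -, -, -, hM⟩ := R.exists_next_write hp hf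
  have hex : ∃ w, HasOutput (R.mem m) w := ⟨w, R.hasOutput_mono hm hw⟩
  have hout : ∃ z, (R.loc (m + 1) p).output = some z := by
    rw [hl]
    simp only [SimData.update, dif_pos hex]
    cases (R.loc m p).output <;> simp
  obtain ⟨⟨q, w'⟩, hz⟩ := hout
  obtain rfl := (R.output_loc hz).1
  exact ⟨m', _, w', hM, hz⟩

end SimRun

/-! ### Correctness of the simulation for colorless tasks -/

theorem simulation_posts_iff (A : Protocol n V W) (S : Finset (Fin n)) (τ : ℕ → Fin n)
    (e : Execution n V) (q : Fin n) (w : W) : (simulation A S τ).Posts e q w ↔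
      ∃ m p y, (simRun A S τ e).mem m p = some y ∧ y.output = some (q, w) := by
  have hout : ∀ c : SimData A, (simulation A S τ).out c q = some w ↔
      c.output = some (q, w) := by
    intro c
    change (c.output.bind fun z => if z.1 = q then some z.2 else none) = some w ↔ _
    rcases c.output with _ | ⟨q', w'⟩
    · simp
    · by_cases h : q' = q <;> simp [h]
  constructor
  · rintro ⟨m, p, y, h1, h2⟩
    exact ⟨m, p, y, h1, (hout y).1 h2⟩
  · rintro ⟨m, p, y, h1, h2⟩
    exact ⟨m, p, y, h1, (hout y).2 h2⟩

theorem exists_round_robin (hn : 0 < n) : ∃ τ : ℕ → Fin n, ∀ j N, ∃ r ≥ N, τ r = j := by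
  refine ⟨fun r => ⟨r % n, Nat.mod_lt r hn⟩, fun j N => ⟨n * N + j, ?_, ?_⟩⟩
  · nlinarith
  · ext
    simp [Nat.mod_eq_of_lt j.2]

/-- The simulation of a protocol for a colorless task that tolerates `t` faulty processes, by
`t + 1` simulators one of which is correct. -/
theorem DistTask.Colorless.exists_simulation {T : DistTask n V W} (hT : T.Colorless)
    {A : Protocol n V W} {t : ℕ}
    (hA : ∀ e, T.IsExecution e → n ≤ e.correct.ncard + t →
      (∃ q, A.Terminates e q) ∧ A.Respects T e)
    {S : Finset (Fin n)} (hS : S.card = t + 1) :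
    ∃ B : Protocol n V W, ∀ e, T.IsExecution e → (∃ p ∈ S, p ∈ e.correct) →
      (∀ q ∈ e.correct, B.Terminates e q) ∧ B.Respects T e := by
  classical
  have hcard : t + 1 ≤ n := by
    rw [← hS]
    simpa using Finset.card_le_univ S
  obtain ⟨τ, hτ⟩ := exists_round_robin (by omega : 0 < n)
  refine ⟨simulation A S τ, fun e he => ?_⟩
  rintro ⟨p, hpS, hp⟩
  set R := simRun A S τ e with hR
  have hncard := R.ncard_infinite hτ hpS hp hS
  have hinf : ∃ j, ∀ N, ∃ m, N < SimData.progress (R.mem m) j := by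
    refine Set.nonempty_of_ncard_ne_zero
      (s := {j | ∀ N, ∃ m, N < SimData.progress (R.mem m) j}) ?_
    omega
  obtain ⟨e', hin, hrun, hrun', hpart, hcorr⟩ := R.exists_execution hinf
  have hval : e'.input.val ⊆ e.input.val := by
    rintro v ⟨j, hj⟩
    rw [hin] at hj
    by_cases h : ∃ m, 0 < SimData.progress (R.mem m) j
    · obtain ⟨q, -, hq⟩ := R.simInput_eq h
      exact ⟨q, hq ▸ hj⟩
    · rw [R.simInput_eq_none h] at hj
      cases hj
  have he' : T.IsExecution e' := by
    refine ⟨hT.inputs_closed _ he.1 _ hval, fun j => ?_⟩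
    rw [hpart, hin]
    constructor
    · intro h
      obtain ⟨q, hq, hq'⟩ := R.simInput_eq h
      rw [hq']
      exact (he.2 q).1 hq
    · intro h
      by_contra hno
      exact h (R.simInput_eq_none hno)
  have hsub : {j | ∀ N, ∃ m, N < SimData.progress (R.mem m) j} ⊆ e'.correct := hcorr
  have hle := Set.ncard_le_ncard hsub (Set.toFinite _)
  obtain ⟨⟨q0, w0, hw0⟩, -, O, hO, hrel⟩ := hA e' he' (by omega)
  have hposts : ∀ w, (∃ m, SimData.HasOutput (R.mem m) w) ↔ ∃ q, A.Posts e' q w := by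
    intro w
    rw [R.hasOutput_iff]
    constructor
    · rintro ⟨m, j, c, q, hc, ho⟩
      obtain ⟨i, hi⟩ := hrun m
      exact ⟨q, i, j, c, by rw [hi, hc], ho⟩
    · rintro ⟨q, i, j, c, hc, ho⟩
      obtain ⟨m, hm⟩ := hrun' i
      exact ⟨m, j, c, q, by rw [← hm, hc], ho⟩
  refine ⟨fun q hq => ?_, fun q w hqw => ?_, ?_⟩
  · obtain ⟨N, hN⟩ := (hposts w0).2 ⟨q0, hw0⟩
    obtain ⟨m, y, w, hy, ho⟩ := R.exists_output hτ hq hN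
    exact ⟨w, (simulation_posts_iff A S τ e q w).2 ⟨m, q, y, hy, ho⟩⟩
  · obtain ⟨m, p', y, hy, ho⟩ := (simulation_posts_iff A S τ e q w).1 hqw
    obtain ⟨rfl, hpp, -⟩ := R.output_mem hy ho
    exact hpp
  -- Both posts come from the register of `q`, where an adopted output is never replaced.
  · have unique : ∀ q w w', (simulation A S τ).Posts e q w →
        (simulation A S τ).Posts e q w' → w = w' := by
      intro q w w' h h'
      obtain ⟨m, p1, y, hy, ho⟩ := (simulation_posts_iff A S τ e q w).1 h
      obtain ⟨m', p2, y', hy', ho'⟩ := (simulation_posts_iff A S τ e q w').1 h'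
      obtain ⟨rfl, -⟩ := R.output_mem hy ho
      obtain ⟨rfl, -⟩ := R.output_mem hy' ho'
      obtain ⟨z, hz, hle⟩ := R.mem_mono (le_max_left m m') hy
      obtain ⟨z', hz', hle'⟩ := R.mem_mono (le_max_right m m') hy'
      have h1 := hle.output _ ho
      have h2 := hle'.output _ ho'
      rw [hz] at hz'
      rw [← Option.some.inj hz', h1] at h2
      exact (Prod.mk.inj (Option.some.inj h2)).2
    have hO' : ∃ O' : Vec n W, ∀ q w, (simulation A S τ).Posts e q w ↔ O' q = some w := by
      refine ⟨fun q => if h : ∃ w, (simulation A S τ).Posts e q w then some h.choose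
        else none, fun q w => ⟨fun h => ?_, fun h => ?_⟩⟩
      · have hex : ∃ w, (simulation A S τ).Posts e q w := ⟨w, h⟩
        beta_reduce
        rw [dif_pos hex, unique q _ _ hex.choose_spec h]
      · beta_reduce at h
        split_ifs at h with hex
        rw [← Option.some.inj h]
        exact hex.choose_spec
    obtain ⟨O', hO'⟩ := hO'
    refine ⟨O', hO', hT.rel_anti _ O (hT.rel_mono _ _ hrel _ he.1 hval) _ ?_⟩
    rintro w ⟨q, hq⟩
    obtain ⟨m, p', y, hy, ho⟩ := (simulation_posts_iff A S τ e q w).1 ((hO' q w).2 hq)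
    obtain ⟨-, -, hi⟩ := R.output_mem hy ho
    obtain ⟨q', hq'⟩ := (hposts w).1 hi
    exact ⟨q', (hO q' w).1 hq'⟩

/-! ### Hitting sets -/

theorem exists_hittingSet {𝓛 : Set (Set (Fin n))} (hemp : ∅ ∉ 𝓛) :
    ∃ H : Finset (Fin n), H.card = hittingSize 𝓛 ∧ ∀ L ∈ 𝓛, ∃ p ∈ H, p ∈ L := by
  refine Nat.sInf_mem (s := {k | ∃ H : Finset (Fin n), H.card = k ∧ ∀ L ∈ 𝓛, ∃ p ∈ H, p ∈ L})
    ⟨_, Finset.univ, rfl, fun L hL => ?_⟩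
  obtain ⟨p, hp⟩ := Set.nonempty_iff_ne_empty.2 fun h => hemp (h ▸ hL)
  exact ⟨p, Finset.mem_univ p, hp⟩

theorem hittingSize_le {𝓛 : Set (Set (Fin n))} {H : Finset (Fin n)}
    (h : ∀ L ∈ 𝓛, ∃ p ∈ H, p ∈ L) : hittingSize 𝓛 ≤ H.card :=
  Nat.sInf_le ⟨H, rfl, h⟩

/-- Both directions simulate with a minimum hitting set as the set of simulators; they differ only
in why the simulated execution yields an output and why a simulator is correct. -/
theorem DistTask.Colorless.weaklySolvable_iff {T : DistTask n V W} (hT : T.Colorless)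
    {𝓛 : Set (Set (Fin n))} (hne : 𝓛.Nonempty) (hemp : ∅ ∉ 𝓛) :
    T.WeaklySolvable 𝓛 ↔ T.ResilientlySolvable (hittingSize 𝓛 - 1) := by
  classical
  obtain ⟨H, hcard, hH⟩ := exists_hittingSet hemp
  -- Positivity makes the truncated `hittingSize 𝓛 - 1` one less than the number of simulators.
  have hpos : 0 < hittingSize 𝓛 := by
    obtain ⟨L, hL⟩ := hne
    obtain ⟨p, hp, -⟩ := hH L hL
    rw [← hcard]
    exact Finset.card_pos.2 ⟨p, hp⟩
  have hle : H.card ≤ n := by simpa using Finset.card_le_univ H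
  have hcompl : ∀ e : Execution n V, e.correct.ncard + e.correctᶜ.ncard = n := fun e => by
    simpa using Set.ncard_add_ncard_compl e.correct
  constructor
  · rintro ⟨A, hA⟩
    obtain ⟨B, hB⟩ := hT.exists_simulation (A := A) (t := hittingSize 𝓛 - 1) (S := H)
      (fun e he hn => by
        obtain ⟨L, hL, hLc⟩ : e.IsResilient 𝓛 := by
          by_contra hno
          -- If no live set were entirely correct, the faulty processes would form a hitting set of
          -- fewer than $h$ elements.
          have hhit := hittingSize_le (𝓛 := 𝓛) (H := e.correctᶜ.toFinset) fun L hL => by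
            obtain ⟨p, hp, hpc⟩ := Set.not_subset.1 fun h => hno ⟨L, hL, h⟩
            exact ⟨p, by simpa using hpc, hp⟩
          rw [← Set.ncard_eq_toFinset_card'] at hhit
          have := hcompl e
          omega
        obtain ⟨⟨L', hL', -, hterm⟩, hresp⟩ := hA e he ⟨L, hL, hLc⟩
        -- The hitting set serves here only to show that the terminated live set is non-empty.
        obtain ⟨p, -, hp⟩ := hH L' hL'
        exact ⟨⟨p, hterm p hp⟩, hresp⟩)
      (by omega)
    refine ⟨B, fun e he hn => hB e he ?_⟩
    by_contra! hno
    have hsub : (H : Set (Fin n)) ⊆ e.correctᶜ := fun p hp => hno p hp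
    have := Set.ncard_le_ncard hsub (Set.toFinite _)
    rw [Set.ncard_coe_finset] at this
    have := hcompl e
    omega
  · rintro ⟨A, hA⟩
    obtain ⟨B, hB⟩ := hT.exists_simulation (A := A) (t := hittingSize 𝓛 - 1) (S := H)
      (fun e he hn => by
        obtain ⟨hterm, hresp⟩ := hA e he hn
        obtain ⟨q, hq⟩ := Set.nonempty_of_ncard_ne_zero (s := e.correct) (by omega)
        exact ⟨⟨q, hterm q hq⟩, hresp⟩)
      (by omega)
    refine ⟨B, fun e he => ?_⟩
    rintro ⟨L, hL, hLc⟩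
    obtain ⟨p, hpH, hpL⟩ := hH L hL
    obtain ⟨hterm, hresp⟩ := hB e he ⟨p, hpH, hLc hpL⟩
    refine ⟨⟨L, hL, fun q hq => ?_, fun q hq => hterm q (hLc hq)⟩, hresp⟩
    obtain ⟨k, -, hk⟩ := hLc hq 0
    exact ⟨k, hk⟩

end Resilience

theorem theorem1 {n : ℕ} (hn : 2 ≤ n) {V W : Type u} (T : Resilience.DistTask n V W)
    (hT : T.Colorless) (𝓛 : Set (Set (Fin n))) (hne : 𝓛.Nonempty) (hemp : ∅ ∉ 𝓛) :
    (T.WeaklySolvable 𝓛 ↔ T.ResilientlySolvable (Resilience.hittingSize 𝓛 - 1)) ∧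
      ∀ 𝓛' : Set (Set (Fin n)), 𝓛'.Nonempty → ∅ ∉ 𝓛' →
        Resilience.hittingSize 𝓛' = Resilience.hittingSize 𝓛 →
        (T.WeaklySolvable 𝓛 ↔ T.WeaklySolvable 𝓛') := by
  refine ⟨hT.weaklySolvable_iff hne hemp, fun 𝓛' hne' hemp' h => ?_⟩
  rw [hT.weaklySolvable_iff hne hemp, hT.weaklySolvable_iff hne' hemp', h]
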